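/- Let $n\ge 2$, let $f_1,\dots,f_m\in\mathbb{Q}[x_1,\dots,x_n]$ be not all zero, let $V=V(f_1,\dots,f_m)\subset\mathbb{C}^n$, and for each $j$ let $V_j$ be the union of the irreducible components of $V$ of dimension $j$. Let $p\in V$. For polynomials $\ell_1,\dots,\ell_{n-1}\in\mathbb{Q}[x_1,\dots,x_n]$ of degree at most $1$ (constant terms allowed), $1\le k\le n-1$ and $s\in\mathbb{C}$, put $$L^{(k)}_s=\{x\in\mathbb{C}^n \mid \ell_i(x)=(1-s)\,\ell_i(p)\ \text{for } 1\le i\le k\},$$ and let $Z^{(k)}\subset\mathbb{C}^{n+1}$ be the union of the irreducible components $C$ of $$(V\times\mathbb{A}^1)\cap\{(x,s)\mid x\in L^{(k)}_s\}$$ whose projection $\pi_s(C)$ to the $s$-line is Zariski dense in $\mathbb{A}^1$. Let $Z^{(k)}_1$ be the union of the irreducible components of $Z^{(k)}$ of dimension $1$. Consider the conditions * (H1) $V_j\cap L^{(k)}_1$ is empty or equidimensional of dimension $j-k$ for every $j\ge k$, and $V_j\cap L^{(k)}_1=\emptyset$ for every $j<k$; * (H2) $V_k\cap\big(\bigcup_{j>k}V_j\big)\cap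 L^{(k)}_1=\emptyset$; * (H3) $V_j\cap L^{(k)}_0$ is empty or equidimensional of dimension $j-k$ for every $j\ge k$, and $V_j\cap L^{(k)}_0$ is empty or equal to $\{p\}$ for every $j<k$. Then for generic $\ell_1,\dots,\ell_{n-1}$, that is, whenever the vector of coefficients (including the constant terms) of $\ell_1,\dots,\ell_{n-1}$ is a rational point at which a certain nonzero complex polynomial, depending only on $n$, $f_1,\dots,f_m$ and $p$, does not vanish, conditions (H1), (H2), (H3) hold for every $1\le k\le n-1$, and moreover: * $p\in V_{n-1}$ if and only if $(p,0)\in Z^{(n-1)}$; * for every $1\le k\le n-1$ such that $p\notin\bigcup_{j>k}V_j$, the following are equivalent: $p\in V_k$; $(p,0)\in Z^{(k)}_1$; $(p,0)\in Z^{(k)}$. -/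

import Mathlib

open MvPolynomial

noncomputable section

/-- Zariski closed subsets of complex affine space with coordinates indexed by `σ`. -/
def IsZariskiClosed {σ : Type} (X : Set (σ → ℂ)) : Prop :=
  ∃ I : Ideal (MvPolynomial σ ℂ), X = zeroLocus ℂ I

/-- Zariski closure of a set of points. -/
def zariskiClosure {σ : Type} (X : Set (σ → ℂ)) : Set (σ → ℂ) :=
  zeroLocus ℂ (vanishingIdeal ℂ X)

/-- Irreducible affine varieties: nonempty Zariski closed sets that are not the union of two
proper Zariski closed subsets. -/
def IsIrreducibleVariety {σ : Type} (C : Set (σ → ℂ)) : Prop :=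
  IsZariskiClosed C ∧ C.Nonempty ∧
    ∀ A B : Set (σ → ℂ), IsZariskiClosed A → IsZariskiClosed B → C ⊆ A ∪ B → C ⊆ A ∨ C ⊆ B

/-- The irreducible components of `X`: its maximal irreducible subvarieties. -/
def varietyComponents {σ : Type} (X : Set (σ → ℂ)) : Set (Set (σ → ℂ)) :=
  {C | Maximal (fun D => IsIrreducibleVariety D ∧ D ⊆ X) C}

/-- Dimension of a variety: the Krull dimension of its coordinate ring (`⊥` for the empty set). -/
def varietyDim {σ : Type} (X : Set (σ → ℂ)) : WithBot ℕ∞ :=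
  ringKrullDim (MvPolynomial σ ℂ ⧸ vanishingIdeal ℂ X)

/-- The union of the irreducible components of `X` of dimension `d`. -/
def equidimComponent {σ : Type} (X : Set (σ → ℂ)) (d : ℕ) : Set (σ → ℂ) :=
  ⋃ C ∈ {C | C ∈ varietyComponents X ∧ varietyDim C = d}, C

/-- `X` is nonempty and all its irreducible components have dimension `d`. -/
def IsEquidimensional {σ : Type} (d : ℕ) (X : Set (σ → ℂ)) : Prop :=
  X.Nonempty ∧ ∀ C ∈ varietyComponents X, varietyDim C = d

/-- The complex variety defined by a family of rational polynomials. -/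
def commonZeros {n m : ℕ} (f : Fin m → MvPolynomial (Fin n) ℚ) : Set (Fin n → ℂ) :=
  {x | ∀ j, aeval x (f j) = 0}

/-- The linear polynomials `ℓ i` with constant term `a (i, none)` and coefficient
`a (i, some j)` at `X j`. -/
def linearPolys {n r : ℕ} (a : Fin r × Option (Fin n) → ℚ) (i : Fin r) :
    MvPolynomial (Fin n) ℚ :=
  C (a (i, none)) + ∑ j, C (a (i, some j)) * X j

/-- The linear variety `L_s`, given by `ℓ i (x) = (1 - s) ℓ i (p)` for the first `k` indices `i`;
so `s = 0` gives `ℓ i (x) = ℓ i (p)` and `s = 1` gives `ℓ i (x) = 0`. -/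
def linearSection {n r : ℕ} (ℓ : Fin r → MvPolynomial (Fin n) ℚ) (p : Fin n → ℂ) (k : ℕ) (s : ℂ) :
    Set (Fin n → ℂ) :=
  {x | ∀ i : Fin r, (i : ℕ) < k → aeval x (ℓ i) = (1 - s) * aeval p (ℓ i)}

/-- Condition (H1), on the section at `s = 1`. -/
def CondH1 {n r : ℕ} (V : Set (Fin n → ℂ)) (ℓ : Fin r → MvPolynomial (Fin n) ℚ)
    (p : Fin n → ℂ) (k : ℕ) : Prop :=
  (∀ j, k ≤ j → equidimComponent V j ∩ linearSection ℓ p k 1 = ∅ ∨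
      IsEquidimensional (j - k) (equidimComponent V j ∩ linearSection ℓ p k 1)) ∧
    ∀ j, j < k → equidimComponent V j ∩ linearSection ℓ p k 1 = ∅

/-- Condition (H2). -/
def CondH2 {n r : ℕ} (V : Set (Fin n → ℂ)) (ℓ : Fin r → MvPolynomial (Fin n) ℚ)
    (p : Fin n → ℂ) (k : ℕ) : Prop :=
  equidimComponent V k ∩ (⋃ j ∈ {j : ℕ | k < j}, equidimComponent V j) ∩
    linearSection ℓ p k 1 = ∅

/-- Condition (H3), on the section at `s = 0`, which passes through `p`. -/
def CondH3 {n r : ℕ} (V : Set (Fin n → ℂ)) (ℓ : Fin r → MvPolynomial (Fin n) ℚ)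
    (p : Fin n → ℂ) (k : ℕ) : Prop :=
  (∀ j, k ≤ j → equidimComponent V j ∩ linearSection ℓ p k 0 = ∅ ∨
      IsEquidimensional (j - k) (equidimComponent V j ∩ linearSection ℓ p k 0)) ∧
    ∀ j, j < k → equidimComponent V j ∩ linearSection ℓ p k 0 = ∅ ∨
      equidimComponent V j ∩ linearSection ℓ p k 0 = {p}

/-- A point of affine `(n+1)`-space is `(x, s)`, with `s` the last coordinate.
This is the cylinder `V × 𝔸¹`. -/
def cylinder {n : ℕ} (V : Set (Fin n → ℂ)) : Set (Fin (n + 1) → ℂ) :=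
  {z | (fun i : Fin n => z i.castSucc) ∈ V}

/-- The family of linear varieties `{(x, s) | x ∈ L_s}`. -/
def sectionFamily {n r : ℕ} (ℓ : Fin r → MvPolynomial (Fin n) ℚ) (p : Fin n → ℂ) (k : ℕ) :
    Set (Fin (n + 1) → ℂ) :=
  {z | (fun i : Fin n => z i.castSucc) ∈ linearSection ℓ p k (z (Fin.last n))}

/-- The projection `(x, s) ↦ s` to the affine line. -/
def projLast {n : ℕ} (z : Fin (n + 1) → ℂ) : Fin 1 → ℂ := fun _ => z (Fin.last n)

/-- The union of the irreducible components of `(V × 𝔸¹) ∩ {(x, s) | x ∈ L_s}` that dominate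
the `s`-line. -/
def deformationVariety {n r : ℕ} (V : Set (Fin n → ℂ)) (ℓ : Fin r → MvPolynomial (Fin n) ℚ)
    (p : Fin n → ℂ) (k : ℕ) : Set (Fin (n + 1) → ℂ) :=
  ⋃ C ∈ {C | C ∈ varietyComponents (cylinder V ∩ sectionFamily ℓ p k) ∧
    zariskiClosure (projLast '' C) = Set.univ}, C

/-- The point `(p, 0)`. -/
def liftZero {n : ℕ} (p : Fin n → ℂ) : Fin (n + 1) → ℂ :=
  Fin.snoc (α := fun _ => ℂ) p 0

end

/-!
The dimension of an irreducible variety is the transcendence degree of its coordinate ring, and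
two bounds on it carry the proof.

*Lower bound.* A component of the intersection of an irreducible variety `C` with `k`
hypersurfaces has dimension at least `dim C - k` (`IsIrreducibleVariety.varietyDim_le_add`). This
is Krull's height theorem combined with the inequality `dim A ≤ ht q + dim A/q` for primes `q` of
a finitely generated domain `A`, which going down transports from a polynomial ring, where it is
proved by induction on the number of variables.

*Upper bound.* Let `a` be the coefficients of the forms `ℓ 1, …, ℓ k`. On the incidence variety of
all `(a, x)` with `x ∈ C` and `ℓ i (x) = 0`, the coefficients of the variables are free parameters
and determine the constant terms. So `a` together with any `e` of the coordinates of `x` satisfies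
a nontrivial polynomial relation as soon as `dim C < k + e`, by counting transcendence degrees
(`IsIrreducibleVariety.exists_relation`). Where some coefficient of this relation, as a polynomial
in the coordinates of `x`, does not vanish at `a`, any `e` coordinates are algebraically dependent
on the fibre over `a`, whose subvarieties therefore have dimension less than `e`. The case `e = 0`
says that the fibre is empty. For sections through `p`, one argues in the same way on each open
set `x t ≠ p t`, where the coefficient of `x t` is determined by the others.

Conditions (H1) and (H3) combine the two bounds; (H2) is the case `e = 0` for the components of `C
∩ D`. For the deformation, suppose that no component of `V` of dimension greater than `k` contains
`p`. By the upper bound at `s = 0`, the point `(p, 0)` is isolated in the fibre over `s = 0`. If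
`p` lies on a component `C` of dimension `k`, the lower bound gives a positive-dimensional
subvariety of the family through `(p, 0)`, which then dominates the `s`-line and is a curve.
Conversely, a component of `V` of dimension less than `k` avoids `L_s` unless `s` is a root of a
polynomial that does not vanish at `s = 1`, so no dominating component lies over it.
-/

/-! ### Dimension of finitely generated domains over a field -/

theorem ringKrullDim_eq_of_isIntegral (R S : Type*) [CommRing R] [CommRing S] [Algebra R S]
    [FaithfulSMul R S] [Algebra.IsIntegral R S] : ringKrullDim S = ringKrullDim R := by
  refine le_antisymm ?_ ?_
  · exact Order.krullDim_le_of_strictMono (PrimeSpectrum.comap (algebraMap R S))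
      fun P Q h => Ideal.IsIntegral.comap_lt_comap (R := R) (I := P.asIdeal) (J := Q.asIdeal) h
  · refine iSup_le fun l => ?_
    obtain ⟨Q, hQ, hQl⟩ := (Ideal.nonempty_primesOver (S := S) l.head.asIdeal).some
    obtain ⟨L, hL, -⟩ := Ideal.exists_ltSeries_of_hasGoingUp l Q
    rw [← hL]
    exact Order.LTSeries.length_le_krullDim L

universe u

section

variable (K A : Type u) [Field K] [CommRing A] [IsDomain A] [Algebra K A]
  [Algebra.FiniteType K A]

/-- The Krull dimension of a finitely generated domain over a field is its transcendence degree: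
both are the number of variables of a Noether normalization. -/
theorem ringKrullDim_eq_toENat_trdeg :
    ringKrullDim A = (Cardinal.toENat (Algebra.trdeg K A) : WithBot ℕ∞) := by
  obtain ⟨s, g, hg, hint⟩ := exists_integral_inj_algHom_of_fg K A
  algebraize [g.toRingHom]
  have : FaithfulSMul (MvPolynomial (Fin s) K) A := (faithfulSMul_iff_algebraMap_injective _ _).2 hg
  have h := trdeg_add_eq K (MvPolynomial (Fin s) K) (A := A)
  rw [trdeg_eq_zero (R := MvPolynomial (Fin s) K), add_zero, MvPolynomial.trdeg_of_isDomain] at h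
  rw [ringKrullDim_eq_of_isIntegral (MvPolynomial (Fin s) K) A, ← h]
  simp

theorem ringKrullDim_eq_natCast_trdeg :
    ringKrullDim A = ((Algebra.trdeg K A).toNat : WithBot ℕ∞) := by
  rw [ringKrullDim_eq_toENat_trdeg K A]
  obtain ⟨d, hd⟩ := Cardinal.lt_aleph0.1 (trdeg_lt_aleph0_of_finiteType (R := K) (S := A))
  simp [hd]

end

/-- Passing to one more variable, either the height or the transcendence degree of the residue
ring of a prime goes up. -/
theorem Polynomial.succ_le_height_add_trdeg {K B : Type u} [Field K] [CommRing B]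
    [IsNoetherianRing B] [Algebra K B] {s : ℕ∞} (p : Ideal (Polynomial B)) [p.IsPrime]
    (hs : s ≤ (p.under B).height + Cardinal.toENat (Algebra.trdeg K (B ⧸ p.under B))) :
    s + 1 ≤ p.height + Cardinal.toENat (Algebra.trdeg K (Polynomial B ⧸ p)) := by
  set q := p.under B with hq
  have hadd := trdeg_add_eq K (B ⧸ q) (A := Polynomial B ⧸ p)
  have hht := Ideal.height_eq_height_add_of_liesOver_of_hasGoingDown q p
  by_cases hpq : p = q.map (algebraMap B (Polynomial B))
  · have : Algebra.Transcendental (B ⧸ q) (Polynomial B ⧸ p) := by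
      refine ⟨Ideal.Quotient.mk p Polynomial.X, fun ⟨f, hf, h⟩ => hf ?_⟩
      obtain ⟨g, rfl⟩ := Polynomial.map_surjective _ Ideal.Quotient.mk_surjective f
      have h1 : Polynomial.aeval (Ideal.Quotient.mk p (Polynomial.X : Polynomial B))
          (g.map (Ideal.Quotient.mk q)) = Ideal.Quotient.mk p g := by
        rw [Polynomial.aeval_def, Polynomial.eval₂_map]
        conv_rhs => rw [← Polynomial.eval₂_C_X (p := g), Polynomial.hom_eval₂]
        rfl
      rw [h1, Ideal.Quotient.eq_zero_iff_mem, hpq] at h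
      ext n
      have := Ideal.mem_map_C_iff.1 h n
      simpa [Ideal.Quotient.eq_zero_iff_mem] using this
    have h1 : (1 : Cardinal) ≤ Algebra.trdeg (B ⧸ q) (Polynomial B ⧸ p) :=
      Cardinal.one_le_iff_pos.2 (trdeg_pos _ _)
    have h2 : (1 : ℕ∞) ≤ Cardinal.toENat (Algebra.trdeg (B ⧸ q) (Polynomial B ⧸ p)) := by
      simpa using Cardinal.toENat.monotone' h1
    rw [hht, ← hadd, map_add]
    calc s + 1 ≤ _ := add_le_add hs h2
      _ ≤ _ := by rw [← add_assoc]; gcongr; exact le_self_add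
  · have h1 : (1 : ℕ∞) ≤
        (p.map (Ideal.Quotient.mk (q.map (algebraMap B (Polynomial B))))).height := by
      have : (q.map (algebraMap B (Polynomial B))).IsPrime := Ideal.isPrime_map_C_of_isPrime
      rw [Order.one_le_iff_ne_zero, Ne, Ideal.height_eq_zero_iff_eq_bot,
        Ideal.map_eq_bot_iff_le_ker, Ideal.mk_ker]
      exact fun h => hpq (le_antisymm h (Ideal.map_le_iff_le_comap.2 le_rfl))
    rw [hht, ← hadd, map_add]
    calc s + 1 ≤ _ := add_le_add hs h1
      _ ≤ _ := by rw [add_right_comm]; gcongr; exact le_self_add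

theorem AlgEquiv.le_height_add_trdeg {K A B : Type*} [Field K] [CommRing A] [CommRing B]
    [Algebra K A] [Algebra K B] {s : ℕ∞} (e : A ≃ₐ[K] B)
    (h : ∀ p : Ideal B, p.IsPrime → s ≤ p.height + Cardinal.toENat (Algebra.trdeg K (B ⧸ p)))
    (p : Ideal A) [p.IsPrime] : s ≤ p.height + Cardinal.toENat (Algebra.trdeg K (A ⧸ p)) := by
  have hp : (p.comap (e.symm : B →+* A)).height = p.height :=
    RingEquiv.height_comap e.symm.toRingEquiv p
  have he : p.comap (e.symm : B →+* A) = p.map (e : A →+* B) :=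
    Ideal.comap_symm e.toRingEquiv
  have ht := (Ideal.quotientEquivAlg p _ e he).lift_trdeg_eq
  have ht' := congrArg Cardinal.toENat ht
  rw [Cardinal.toENat_lift, Cardinal.toENat_lift] at ht'
  rw [ht', ← hp]
  exact h _ inferInstance

/-- In a polynomial ring over a field, the height of a prime and the transcendence degree of its
residue ring add up to at least the number of variables. -/
theorem MvPolynomial.le_height_add_trdeg {K : Type*} [Field K] (s : ℕ)
    (p : Ideal (MvPolynomial (Fin s) K)) [p.IsPrime] :
    (s : ℕ∞) ≤ p.height + Cardinal.toENat (Algebra.trdeg K (MvPolynomial (Fin s) K ⧸ p)) := by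
  induction s with
  | zero => simp
  | succ s ih =>
    rw [Nat.cast_succ]
    exact (MvPolynomial.finSuccEquiv K s).le_height_add_trdeg
      (fun p _ => Polynomial.succ_le_height_add_trdeg p (ih _)) p

/-- Each of `k` equations lowers the dimension of a component by at most one. -/
theorem trdeg_le_trdeg_quotient_add_of_mem_minimalPrimes {K A : Type u} [Field K] [CommRing A]
    [IsDomain A] [Algebra K A] [Algebra.FiniteType K A] {k : ℕ} (g : Fin k → A) (q : Ideal A)
    (hq : q ∈ (Ideal.span (Set.range g)).minimalPrimes) :
    Cardinal.toENat (Algebra.trdeg K A) ≤ Cardinal.toENat (Algebra.trdeg K (A ⧸ q)) + k := by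
  have : q.IsPrime := hq.1.1
  have : IsNoetherianRing A := Algebra.FiniteType.isNoetherianRing K A
  obtain ⟨s, φ, hφ, hint⟩ := exists_integral_inj_algHom_of_fg K A
  algebraize [φ.toRingHom]
  have : FaithfulSMul (MvPolynomial (Fin s) K) A := (faithfulSMul_iff_algebraMap_injective _ _).2 hφ
  have hA := trdeg_add_eq K (MvPolynomial (Fin s) K) (A := A)
  rw [trdeg_eq_zero (R := MvPolynomial (Fin s) K), add_zero, MvPolynomial.trdeg_of_isDomain] at hA
  set p := q.under (MvPolynomial (Fin s) K) with hp
  have hk : q.height ≤ k := by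
    refine (Ideal.height_le_card_of_mem_minimalPrimes_span (Set.finite_range g) hq).trans ?_
    rw [← Set.image_univ]
    exact_mod_cast (Set.ncard_image_le Set.finite_univ).trans_eq (by simp)
  have hpq : p.height ≤ q.height := by
    rw [Ideal.height_eq_height_add_of_liesOver_of_hasGoingDown p q]
    exact le_self_add
  have ht : Algebra.trdeg K (MvPolynomial (Fin s) K ⧸ p) ≤ Algebra.trdeg K (A ⧸ q) := by
    rw [← trdeg_add_eq K (MvPolynomial (Fin s) K ⧸ p) (A := A ⧸ q)]
    exact le_self_add
  calc Cardinal.toENat (Algebra.trdeg K A) = s := by rw [← hA]; simp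
    _ ≤ p.height + Cardinal.toENat (Algebra.trdeg K (MvPolynomial (Fin s) K ⧸ p)) :=
      MvPolynomial.le_height_add_trdeg s p
    _ ≤ k + Cardinal.toENat (Algebra.trdeg K (A ⧸ q)) :=
      add_le_add (hpq.trans hk) (Cardinal.toENat.monotone' ht)
    _ = _ := add_comm _ _

theorem ringKrullDim_le_ringKrullDim_quotient_add_of_mem_minimalPrimes (K : Type u) {A : Type u}
    [Field K] [CommRing A] [IsDomain A] [Algebra K A] [Algebra.FiniteType K A] {k : ℕ}
    (g : Fin k → A) (q : Ideal A) (hq : q ∈ (Ideal.span (Set.range g)).minimalPrimes) :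
    ringKrullDim A ≤ ringKrullDim (A ⧸ q) + k := by
  have : q.IsPrime := hq.1.1
  rw [ringKrullDim_eq_toENat_trdeg K A, ringKrullDim_eq_toENat_trdeg K (A ⧸ q)]
  exact_mod_cast trdeg_le_trdeg_quotient_add_of_mem_minimalPrimes (K := K) g q hq

/-! ### Zariski closed sets and irreducible components -/

section Zariski

variable {σ τ : Type}

theorem isZariskiClosed_iff {X : Set (σ → ℂ)} :
    IsZariskiClosed X ↔ zeroLocus ℂ (vanishingIdeal ℂ X) = X := by
  refine ⟨?_, fun h => ⟨_, h.symm⟩⟩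
  rintro ⟨I, rfl⟩
  exact zeroLocus_vanishingIdeal_galoisConnection.l_u_l_eq_l I

theorem IsZariskiClosed.zeroLocus_vanishingIdeal {X : Set (σ → ℂ)} (h : IsZariskiClosed X) :
    zeroLocus ℂ (vanishingIdeal ℂ X) = X := isZariskiClosed_iff.1 h

theorem IsZariskiClosed.vanishingIdeal_le_iff {X Y : Set (σ → ℂ)} (h : IsZariskiClosed X) :
    vanishingIdeal ℂ X ≤ vanishingIdeal ℂ Y ↔ Y ⊆ X := by
  rw [← le_zeroLocus_iff_le_vanishingIdeal, h.zeroLocus_vanishingIdeal]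

theorem isZariskiClosed_setOf_forall {ι : Type*} (g : ι → MvPolynomial σ ℂ) :
    IsZariskiClosed {x | ∀ i, aeval x (g i) = 0} :=
  ⟨Ideal.span (Set.range g), by rw [zeroLocus_span]; ext; simp⟩

theorem isZariskiClosed_setOf (g : MvPolynomial σ ℂ) : IsZariskiClosed {x | aeval x g = 0} := by
  simpa using isZariskiClosed_setOf_forall fun _ : Unit => g

theorem isZariskiClosed_iInter {ι : Sort*} {X : ι → Set (σ → ℂ)}
    (h : ∀ i, IsZariskiClosed (X i)) : IsZariskiClosed (⋂ i, X i) := by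
  rw [isZariskiClosed_iff]
  refine (Set.subset_iInter fun i => ?_).antisymm (zeroLocus_vanishingIdeal_le _)
  rw [← (h i).vanishingIdeal_le_iff]
  refine (vanishingIdeal_anti_mono (Set.iInter_subset X i)).trans ?_
  exact le_vanishingIdeal_zeroLocus _

theorem IsZariskiClosed.inter {X Y : Set (σ → ℂ)} (hX : IsZariskiClosed X)
    (hY : IsZariskiClosed Y) : IsZariskiClosed (X ∩ Y) := by
  rw [Set.inter_eq_iInter]
  exact isZariskiClosed_iInter fun b => by cases b <;> assumption

theorem isZariskiClosed_empty : IsZariskiClosed (∅ : Set (σ → ℂ)) := ⟨⊤, by simp⟩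

theorem IsZariskiClosed.union {X Y : Set (σ → ℂ)} (hX : IsZariskiClosed X)
    (hY : IsZariskiClosed Y) : IsZariskiClosed (X ∪ Y) := by
  refine ⟨vanishingIdeal ℂ X * vanishingIdeal ℂ Y, Set.Subset.antisymm ?_ fun x hx => ?_⟩
  · refine le_zeroLocus_iff_le_vanishingIdeal.2 (Ideal.mul_le.2 fun f hf g hg x hx => ?_)
    rcases hx with hx | hx
    · rw [map_mul, hf x hx, zero_mul]
    · rw [map_mul, hg x hx, mul_zero]
  · by_contra hxn
    rw [Set.mem_union, not_or, ← hX.zeroLocus_vanishingIdeal, ← hY.zeroLocus_vanishingIdeal] at hxn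
    simp only [mem_zeroLocus_iff, not_forall] at hxn
    obtain ⟨⟨f, hf, hfx⟩, g, hg, hgx⟩ := hxn
    have := hx _ (Ideal.mul_mem_mul hf hg)
    rw [map_mul] at this
    exact (mul_ne_zero hfx hgx) this

theorem isZariskiClosed_biUnion {S : Set (Set (σ → ℂ))} (hS : S.Finite)
    (h : ∀ C ∈ S, IsZariskiClosed C) : IsZariskiClosed (⋃ C ∈ S, C) := by
  induction S, hS using Set.Finite.induction_on with
  | empty => simpa using isZariskiClosed_empty
  | insert _ _ ih =>
    rw [Set.biUnion_insert]
    exact (h _ (by simp)).union (ih fun C hC => h C (by simp [hC]))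

/-- Polynomial maps are continuous for the Zariski topology. -/
theorem IsZariskiClosed.preimage {X : Set (σ → ℂ)} (hX : IsZariskiClosed X)
    (ψ : σ → MvPolynomial τ ℂ) : IsZariskiClosed {y | (fun i => aeval y (ψ i)) ∈ X} := by
  obtain ⟨I, rfl⟩ := hX
  refine ⟨I.map (aeval ψ : MvPolynomial σ ℂ →ₐ[ℂ] _), ?_⟩
  ext y
  rw [Ideal.map, zeroLocus_span]
  have (f : MvPolynomial σ ℂ) : aeval y (aeval ψ f) = aeval (fun i => aeval y (ψ i)) f := by
    rw [← AlgHom.comp_apply, comp_aeval]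
  simp only [mem_zeroLocus_iff, Set.mem_ofPred_eq, SetLike.mem_coe, Set.forall_mem_image, this]

/-- An irreducible variety covered by finitely many closed sets lies in one of them. -/
theorem IsIrreducibleVariety.exists_subset_of_subset_biUnion {W : Set (σ → ℂ)}
    (hW : IsIrreducibleVariety W) {S : Set (Set (σ → ℂ))} (hS : S.Finite)
    (h : ∀ C ∈ S, IsZariskiClosed C) (hWS : W ⊆ ⋃ C ∈ S, C) : ∃ C ∈ S, W ⊆ C := by
  induction S, hS using Set.Finite.induction_on with
  | empty =>
    obtain ⟨x, hx⟩ := hW.2.1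
    simpa using hWS hx
  | insert _ hs ih =>
    rw [Set.biUnion_insert] at hWS
    have hs' := fun C hC => h C (Set.mem_insert_of_mem _ hC)
    rcases hW.2.2 _ _ (h _ (by simp)) (isZariskiClosed_biUnion hs hs') hWS with h1 | h1
    · exact ⟨_, by simp, h1⟩
    · obtain ⟨C, hC, hWC⟩ := ih hs' h1
      exact ⟨C, by simp [hC], hWC⟩

theorem IsIrreducibleVariety.isPrime {C : Set (σ → ℂ)} (hC : IsIrreducibleVariety C) :
    (vanishingIdeal ℂ C).IsPrime := by
  obtain ⟨hcl, ⟨x, hx⟩, hirr⟩ := hC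
  refine ⟨fun h => ?_, fun {f g} hfg => ?_⟩
  · have : (1 : MvPolynomial σ ℂ) ∈ vanishingIdeal ℂ C := h ▸ Submodule.mem_top
    simpa using this x hx
  · refine (hirr _ _ (isZariskiClosed_setOf f) (isZariskiClosed_setOf g) fun y hy => ?_).imp
      (fun h y hy => h hy) fun h y hy => h hy
    have := hfg y hy
    rw [map_mul] at this
    exact mul_eq_zero.1 this

theorem isIrreducibleVariety_singleton (x : σ → ℂ) : IsIrreducibleVariety {x} := by
  refine ⟨?_, Set.singleton_nonempty x, fun A B _ _ h => by simpa using h⟩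
  convert isZariskiClosed_setOf_forall fun i : σ => (X i - C (x i) : MvPolynomial σ ℂ)
  ext y
  simp [sub_eq_zero, funext_iff]

theorem varietyDim_mono {X Y : Set (σ → ℂ)} (h : X ⊆ Y) : varietyDim X ≤ varietyDim Y :=
  ringKrullDim_le_of_surjective (Ideal.Quotient.factor (vanishingIdeal_anti_mono h))
    (Ideal.Quotient.factor_surjective _)

theorem varietyDim_singleton (x : σ → ℂ) : varietyDim {x} = 0 := by
  let := Ideal.Quotient.field (vanishingIdeal ℂ {x})
  exact ringKrullDim_eq_zero_of_field _

variable [Finite σ]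

theorem isIrreducibleVariety_zeroLocus (P : Ideal (MvPolynomial σ ℂ)) [hP : P.IsPrime] :
    IsIrreducibleVariety (zeroLocus ℂ P) := by
  refine ⟨⟨P, rfl⟩, ?_, fun A B hA hB h => ?_⟩
  · by_contra hne
    rw [Set.not_nonempty_iff_eq_empty] at hne
    apply hP.ne_top
    rw [← IsPrime.vanishingIdeal_zeroLocus (K := ℂ) P, hne, vanishingIdeal_empty]
  · rw [← hA.vanishingIdeal_le_iff, ← hB.vanishingIdeal_le_iff,
      IsPrime.vanishingIdeal_zeroLocus (K := ℂ) P, ← hP.mul_le]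
    refine Ideal.mul_le.2 fun f hf g hg => ?_
    rw [← IsPrime.vanishingIdeal_zeroLocus (K := ℂ) P]
    intro x hx
    rcases h hx with hx | hx
    · rw [map_mul, hf x hx, zero_mul]
    · rw [map_mul, hg x hx, mul_zero]

/-- By the Nullstellensatz, irreducible components correspond to minimal primes. -/
theorem mem_varietyComponents_zeroLocus {I : Ideal (MvPolynomial σ ℂ)} {W : Set (σ → ℂ)} :
    W ∈ varietyComponents (zeroLocus ℂ I) ↔
      IsZariskiClosed W ∧ vanishingIdeal ℂ W ∈ I.minimalPrimes := by
  constructor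
  · rintro ⟨⟨hW, hWI⟩, hmax⟩
    refine ⟨hW.1, ⟨hW.isPrime, le_zeroLocus_iff_le_vanishingIdeal.1 hWI⟩, fun Q ⟨hQ, hIQ⟩ hQW => ?_⟩
    have h1 : W ⊆ zeroLocus ℂ Q := le_zeroLocus_iff_le_vanishingIdeal.2 hQW
    have h2 := hmax ⟨isIrreducibleVariety_zeroLocus Q, zeroLocus_anti_mono hIQ⟩ h1
    simpa using vanishingIdeal_anti_mono (k := ℂ) h2
  · rintro ⟨hW, ⟨hp, hI⟩, hmin⟩
    have hirr := isIrreducibleVariety_zeroLocus (vanishingIdeal ℂ W)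
    rw [hW.zeroLocus_vanishingIdeal] at hirr
    refine ⟨⟨hirr, le_zeroLocus_iff_le_vanishingIdeal.2 hI⟩, fun D ⟨hD, hDI⟩ hWD => ?_⟩
    exact hW.vanishingIdeal_le_iff.1
      (hmin ⟨hD.isPrime, le_zeroLocus_iff_le_vanishingIdeal.1 hDI⟩ (vanishingIdeal_anti_mono hWD))

theorem IsZariskiClosed.finite_varietyComponents {X : Set (σ → ℂ)} (hX : IsZariskiClosed X) :
    (varietyComponents X).Finite := by
  obtain ⟨I, rfl⟩ := hX
  refine Set.Finite.of_injOn (f := vanishingIdeal ℂ) (t := I.minimalPrimes)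
    (fun W hW => (mem_varietyComponents_zeroLocus.1 hW).2) (fun W hW W' hW' h => ?_)
    (Ideal.finite_minimalPrimes_of_isNoetherianRing _ I)
  rw [← hW.1.1.1.zeroLocus_vanishingIdeal, h, hW'.1.1.1.zeroLocus_vanishingIdeal]

/-- Since the polynomial ring is Noetherian, every irreducible subset of a closed set lies in one of
its components. -/
theorem IsZariskiClosed.exists_mem_varietyComponents {X D : Set (σ → ℂ)} (hX : IsZariskiClosed X)
    (hD : IsIrreducibleVariety D) (hDX : D ⊆ X) : ∃ W ∈ varietyComponents X, D ⊆ W := by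
  obtain ⟨I, rfl⟩ := hX
  have := hD.isPrime
  obtain ⟨P, hP, hPD⟩ := Ideal.exists_minimalPrimes_le (le_zeroLocus_iff_le_vanishingIdeal.1 hDX)
  have : P.IsPrime := hP.1.1
  refine ⟨zeroLocus ℂ P, mem_varietyComponents_zeroLocus.2 ⟨⟨P, rfl⟩, ?_⟩,
    le_zeroLocus_iff_le_vanishingIdeal.2 hPD⟩
  rwa [IsPrime.vanishingIdeal_zeroLocus]

theorem IsZariskiClosed.exists_mem_varietyComponents_of_mem {X : Set (σ → ℂ)} {x : σ → ℂ}
    (hX : IsZariskiClosed X) (hx : x ∈ X) : ∃ W ∈ varietyComponents X, x ∈ W := by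
  simpa using hX.exists_mem_varietyComponents (isIrreducibleVariety_singleton x) (by simpa using hx)

/-! ### Dimension of irreducible varieties -/

theorem IsIrreducibleVariety.varietyDim_eq {C : Set (σ → ℂ)} (hC : IsIrreducibleVariety C) :
    varietyDim C =
      ((Algebra.trdeg ℂ (MvPolynomial σ ℂ ⧸ vanishingIdeal ℂ C)).toNat : WithBot ℕ∞) := by
  have := hC.isPrime
  exact ringKrullDim_eq_natCast_trdeg ℂ _

theorem IsIrreducibleVariety.exists_varietyDim_eq {C : Set (σ → ℂ)}
    (hC : IsIrreducibleVariety C) : ∃ d : ℕ, varietyDim C = d := ⟨_, hC.varietyDim_eq⟩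

theorem IsIrreducibleVariety.varietyDim_lt {C W : Set (σ → ℂ)} (hC : IsIrreducibleVariety C)
    (hW : IsIrreducibleVariety W) (h : W ⊂ C) : varietyDim W < varietyDim C := by
  have := hC.isPrime
  obtain ⟨f, hfW, hfC⟩ : ∃ f ∈ vanishingIdeal ℂ W, f ∉ vanishingIdeal ℂ C := by
    by_contra! hcon
    exact h.2 (hW.1.vanishingIdeal_le_iff.1 hcon)
  have h1 := ringKrullDim_succ_le_of_surjective
    (Ideal.Quotient.factor (vanishingIdeal_anti_mono h.1))
    (Ideal.Quotient.factor_surjective _) (r := Ideal.Quotient.mk (vanishingIdeal ℂ C) f)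
    (mem_nonZeroDivisors_of_ne_zero (by rwa [Ne, Ideal.Quotient.eq_zero_iff_mem]))
    (by simpa [Ideal.Quotient.eq_zero_iff_mem] using hfW)
  change varietyDim W + 1 ≤ varietyDim C at h1
  obtain ⟨d, hd⟩ := hW.exists_varietyDim_eq
  refine lt_of_lt_of_le ?_ h1
  rw [hd]
  exact_mod_cast Nat.lt_succ_self d

theorem IsIrreducibleVariety.eq_singleton {C : Set (σ → ℂ)} (hC : IsIrreducibleVariety C)
    (h : varietyDim C < 1) {x : σ → ℂ} (hx : x ∈ C) : C = {x} := by
  by_contra hne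
  have := hC.varietyDim_lt (isIrreducibleVariety_singleton x)
    (Set.ssubset_iff_subset_ne.2 ⟨by simpa using hx, Ne.symm hne⟩)
  rw [varietyDim_singleton] at this
  obtain ⟨d, hd⟩ := hC.exists_varietyDim_eq
  rw [hd] at h this
  norm_cast at h this
  omega

/-- A component of the intersection of an irreducible variety with `k` hypersurfaces has
codimension at most `k`. -/
theorem IsIrreducibleVariety.varietyDim_le_add {C W : Set (σ → ℂ)} (hC : IsIrreducibleVariety C)
    {k : ℕ} (g : Fin k → MvPolynomial σ ℂ)
    (hW : W ∈ varietyComponents (C ∩ {x | ∀ i, aeval x (g i) = 0})) :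
    varietyDim C ≤ varietyDim W + k := by
  have := hC.isPrime
  set P := vanishingIdeal ℂ C with hP
  have hX : C ∩ {x | ∀ i, aeval x (g i) = 0} = zeroLocus ℂ (Ideal.span (Set.range g) ⊔ P) := by
    rw [zeroLocus_vanishingIdeal_galoisConnection.l_sup]
    change _ = _ ∩ _
    rw [zeroLocus_span, hP, hC.1.zeroLocus_vanishingIdeal, Set.inter_comm]
    simp
  rw [hX, mem_varietyComponents_zeroLocus] at hW
  have hPW : P ≤ vanishingIdeal ℂ W := le_sup_right.trans hW.2.1.2
  have hq : (vanishingIdeal ℂ W).map (Ideal.Quotient.mk P) ∈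
      (Ideal.span (Set.range (Ideal.Quotient.mk P ∘ g))).minimalPrimes := by
    rw [Set.range_comp, ← Ideal.map_span,
      Ideal.minimalPrimes_map_of_surjective Ideal.Quotient.mk_surjective, Ideal.mk_ker]
    exact ⟨_, hW.2, rfl⟩
  have := ringKrullDim_le_ringKrullDim_quotient_add_of_mem_minimalPrimes ℂ _ _ hq
  rwa [ringKrullDim_eq_of_ringEquiv (DoubleQuot.quotQuotEquivQuotOfLE hPW)] at this

/-- If every `e` coordinates are algebraically dependent on an irreducible variety, its dimension
is less than `e`, since some coordinates form a transcendence basis of its function field. -/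
theorem IsIrreducibleVariety.varietyDim_lt_of_forall_exists {W : Set (σ → ℂ)}
    (hW : IsIrreducibleVariety W) {e : ℕ}
    (h : ∀ u : Fin e → σ, ∃ F : MvPolynomial (Fin e) ℂ, F ≠ 0 ∧ ∀ x ∈ W, aeval (x ∘ u) F = 0) :
    varietyDim W < e := by
  have := hW.isPrime
  rw [hW.varietyDim_eq]
  norm_cast
  by_contra! hle
  set A := MvPolynomial σ ℂ ⧸ vanishingIdeal ℂ W
  let c : σ → A := fun i => Ideal.Quotient.mk _ (X i)
  have hc : Algebra.adjoin ℂ (Set.range c) = ⊤ := by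
    have := congrArg (Subalgebra.map (Ideal.Quotient.mkₐ ℂ (vanishingIdeal ℂ W)))
      (MvPolynomial.adjoin_range_X (R := ℂ) (σ := σ))
    rw [AlgHom.map_adjoin, ← Set.range_comp, Algebra.map_top,
      (AlgHom.range_eq_top _).2 (Ideal.Quotient.mkₐ_surjective _ _)] at this
    exact this
  have halg : Algebra.IsAlgebraic (Algebra.adjoin ℂ (Set.range c)) A := by
    refine ⟨fun a => ?_⟩
    exact isAlgebraic_algebraMap (⟨a, hc ▸ Algebra.mem_top⟩ : Algebra.adjoin ℂ (Set.range c))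
  obtain ⟨t, htc, ht⟩ := exists_isTranscendenceBasis_subset (R := ℂ) (Set.range c)
  have hcard := ht.cardinalMk_eq_trdeg
  have htf : t.Finite := (Set.finite_range c).subset htc
  have := htf.fintype
  rw [← hcard, Cardinal.mk_toNat_eq_card] at hle
  obtain ⟨v⟩ : Nonempty (Fin e ↪ t) := Function.Embedding.nonempty_of_card_le (by simpa using hle)
  choose u hu using fun i => htc (v i).2
  obtain ⟨F, hF, hFW⟩ := h u
  have hind : AlgebraicIndependent ℂ (fun i => c (u i)) := by
    have := ht.1.comp v v.injective
    convert this using 2 with i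
    exact hu i
  refine hF (hind.eq_zero_of_aeval_eq_zero F ?_)
  have h1 : aeval (fun i => c (u i)) F =
      Ideal.Quotient.mkₐ ℂ (vanishingIdeal ℂ W) (rename u F) := by
    rw [aeval_unique (Ideal.Quotient.mkₐ ℂ (vanishingIdeal ℂ W)), aeval_rename]; rfl
  rw [h1, Ideal.Quotient.mkₐ_eq_mk, Ideal.Quotient.eq_zero_iff_mem]
  intro x hx
  rw [aeval_rename]
  exact hFW x hx

end Zariski

/-! ### Cylinders -/

section Cylinder

variable {n : ℕ}

theorem isZariskiClosed_cylinder {V : Set (Fin n → ℂ)} (hV : IsZariskiClosed V) :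
    IsZariskiClosed (cylinder V) := by
  simpa [cylinder] using hV.preimage fun i : Fin n => (X i.castSucc : MvPolynomial (Fin (n + 1)) ℂ)

/-- The slice of a Zariski closed set at a fixed value of the last coordinate is closed. -/
theorem IsZariskiClosed.slice {A : Set (Fin (n + 1) → ℂ)} (hA : IsZariskiClosed A) (s : ℂ) :
    IsZariskiClosed {x : Fin n → ℂ | (Fin.snoc x s : Fin (n + 1) → ℂ) ∈ A} := by
  convert hA.preimage (Fin.snoc (fun i => X i) (C s) : Fin (n + 1) → MvPolynomial (Fin n) ℂ)
    using 4 with x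
  funext i
  refine Fin.lastCases ?_ (fun i => ?_) i <;> simp

theorem snoc_mem_cylinder {V : Set (Fin n → ℂ)} {x : Fin n → ℂ} {s : ℂ} :
    (Fin.snoc x s : Fin (n + 1) → ℂ) ∈ cylinder V ↔ x ∈ V := by
  simp [cylinder]

theorem snoc_castSucc_last (z : Fin (n + 1) → ℂ) :
    (Fin.snoc (fun i : Fin n => z i.castSucc) (z (Fin.last n)) : Fin (n + 1) → ℂ) = z :=
  Fin.snoc_init_self z

/-- The product of an irreducible variety with the affine line is irreducible: the lines
`{x} × 𝔸¹` lying in a closed set form the intersection of all its slices, which is closed. -/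
theorem IsIrreducibleVariety.cylinder {C : Set (Fin n → ℂ)} (hC : IsIrreducibleVariety C) :
    IsIrreducibleVariety (cylinder C) := by
  refine ⟨isZariskiClosed_cylinder hC.1, ?_, fun A B hA hB h => ?_⟩
  · obtain ⟨x, hx⟩ := hC.2.1
    exact ⟨_, snoc_mem_cylinder (s := 0).2 hx⟩
  have key (D : Set (Fin (n + 1) → ℂ)) :
      C ⊆ ⋂ s : ℂ, {x : Fin n → ℂ | (Fin.snoc x s : Fin (n + 1) → ℂ) ∈ D} →
        _root_.cylinder C ⊆ D := by
    intro hD z hz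
    have := Set.mem_iInter.1 (hD hz) (z (Fin.last n))
    rwa [Set.mem_ofPred_eq, snoc_castSucc_last] at this
  refine (hC.2.2 _ _ (isZariskiClosed_iInter fun s => hA.slice s)
    (isZariskiClosed_iInter fun s => hB.slice s) fun x hx => ?_).imp (key A) (key B)
  -- the line over `x` is irreducible, being the image of the affine line
  have hline := isIrreducibleVariety_zeroLocus (⊥ : Ideal (MvPolynomial (Fin 1) ℂ))
  have hcl {D : Set (Fin (n + 1) → ℂ)} (hD : IsZariskiClosed D) :
      IsZariskiClosed {t : Fin 1 → ℂ | (Fin.snoc x (t 0) : Fin (n + 1) → ℂ) ∈ D} := by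
    convert hD.preimage
      (Fin.snoc (fun i => MvPolynomial.C (x i)) (X 0) :
        Fin (n + 1) → MvPolynomial (Fin 1) ℂ) using 4 with t
    funext i
    refine Fin.lastCases ?_ (fun i => ?_) i <;> simp
  refine (hline.2.2 _ _ (hcl hA) (hcl hB) fun t _ => h (snoc_mem_cylinder.2 hx)).imp ?_ ?_ <;>
  · intro ht
    rw [zeroLocus_bot] at ht
    exact Set.mem_iInter.2 fun s => @ht (fun _ => s) trivial

/-- The projection to the first coordinates of an irreducible set lying in a fibre of the last
coordinate. -/
theorem IsIrreducibleVariety.slice {T : Set (Fin (n + 1) → ℂ)} (hT : IsIrreducibleVariety T)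
    {s : ℂ} (h : ∀ z ∈ T, z (Fin.last n) = s) :
    IsIrreducibleVariety {x : Fin n → ℂ | (Fin.snoc x s : Fin (n + 1) → ℂ) ∈ T} := by
  have hz (z) (hzT : z ∈ T) :
      (Fin.snoc (fun i : Fin n => z i.castSucc) s : Fin (n + 1) → ℂ) = z := by
    rw [← h z hzT, snoc_castSucc_last]
  refine ⟨hT.1.slice s, ?_, fun A B hA hB hAB => ?_⟩
  · obtain ⟨z, hzT⟩ := hT.2.1
    exact ⟨fun i => z i.castSucc, by simpa [hz z hzT] using hzT⟩
  · refine (hT.2.2 _ _ (isZariskiClosed_cylinder hA) (isZariskiClosed_cylinder hB)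
      fun z hzT => hAB ?_).imp (fun h x hx => ?_) fun h x hx => ?_
    · simpa [hz z hzT] using hzT
    · exact snoc_mem_cylinder.1 (h hx)
    · exact snoc_mem_cylinder.1 (h hx)

/-- The cylinder over `C` properly contains the irreducible set `C × {0}`, whose coordinate ring
maps onto that of `C`. -/
theorem IsIrreducibleVariety.add_one_le_varietyDim_cylinder {C : Set (Fin n → ℂ)}
    (hC : IsIrreducibleVariety C) {d : ℕ} (hd : varietyDim C = d) :
    (d + 1 : ℕ) ≤ varietyDim (_root_.cylinder C) := by
  set W : Set (Fin (n + 1) → ℂ) := {z | z ∈ _root_.cylinder C ∧ z (Fin.last n) = 0} with hWdef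
  have hWcl : IsZariskiClosed W := by
    have := (isZariskiClosed_cylinder hC.1).inter (isZariskiClosed_setOf (X (Fin.last n)))
    simp only [aeval_X] at this
    exact this
  have hW : IsIrreducibleVariety W := by
    refine ⟨hWcl, ?_, fun A B hA hB h => ?_⟩
    · obtain ⟨x, hx⟩ := hC.2.1
      exact ⟨Fin.snoc x 0, snoc_mem_cylinder.2 hx, by simp⟩
    · have key (D : Set (Fin (n + 1) → ℂ))
          (hD : C ⊆ {x : Fin n → ℂ | (Fin.snoc x 0 : Fin (n + 1) → ℂ) ∈ D}) : W ⊆ D := by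
        intro z hz
        have := hD hz.1
        rwa [Set.mem_ofPred_eq, ← hz.2, snoc_castSucc_last] at this
      exact (hC.2.2 _ _ (hA.slice 0) (hB.slice 0)
        fun x hx => h ⟨snoc_mem_cylinder.2 hx, by simp⟩).imp (key A) (key B)
  have hdW : varietyDim C ≤ varietyDim W := by
    let φ : MvPolynomial (Fin (n + 1)) ℂ →ₐ[ℂ] MvPolynomial (Fin n) ℂ :=
      aeval (Fin.snoc (fun i => X i) 0 : Fin (n + 1) → MvPolynomial (Fin n) ℂ)
    have hφ (x : Fin n → ℂ) (f) : aeval x (φ f) = aeval (Fin.snoc x 0 : Fin (n + 1) → ℂ) f := by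
      rw [← AlgHom.comp_apply, comp_aeval]
      congr 2
      funext i
      refine Fin.lastCases ?_ (fun i => ?_) i <;> simp
    have hle : vanishingIdeal ℂ W ≤ (vanishingIdeal ℂ C).comap φ := by
      intro f hf x hx
      rw [hφ]
      exact hf _ ⟨snoc_mem_cylinder.2 hx, by simp⟩
    refine ringKrullDim_le_of_surjective (Ideal.quotientMap (vanishingIdeal ℂ C) φ.toRingHom hle) ?_
    refine Ideal.quotientMap_surjective fun f => ⟨rename Fin.castSucc f, ?_⟩
    change aeval _ (rename _ f) = f
    rw [aeval_rename]
    convert aeval_X_left_apply f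
    funext i
    simp
  have hlt := hC.cylinder.varietyDim_lt hW ⟨fun z hz => hz.1, fun h => ?_⟩
  · obtain ⟨e, he⟩ := hC.cylinder.exists_varietyDim_eq
    have := hdW.trans_lt hlt
    rw [hd, he] at this
    rw [he]
    norm_cast at this ⊢
  · obtain ⟨x, hx⟩ := hC.2.1
    have := (h (snoc_mem_cylinder (s := 1).2 hx)).2
    simp at this

end Cylinder

/-! ### Generic choices of parameters -/

section Generic

variable {τ ε σ : Type}

/-- A property of parameter vectors holds generically if it holds wherever a certain nonzero
polynomial does not vanish. -/
def HoldsGenerically (Q : (τ → ℂ) → Prop) : Prop :=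
  ∃ G : MvPolynomial τ ℂ, G ≠ 0 ∧ ∀ a, aeval a G ≠ 0 → Q a

theorem HoldsGenerically.mono {Q Q' : (τ → ℂ) → Prop} (h : HoldsGenerically Q)
    (hQ : ∀ a, Q a → Q' a) : HoldsGenerically Q' := by
  obtain ⟨G, hG, h⟩ := h
  exact ⟨G, hG, fun a ha => hQ a (h a ha)⟩

theorem holdsGenerically_of_forall {Q : (τ → ℂ) → Prop} (h : ∀ a, Q a) : HoldsGenerically Q :=
  ⟨1, one_ne_zero, fun a _ => h a⟩

theorem HoldsGenerically.and {Q Q' : (τ → ℂ) → Prop} (h : HoldsGenerically Q)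
    (h' : HoldsGenerically Q') : HoldsGenerically fun a => Q a ∧ Q' a := by
  obtain ⟨G, hG, h⟩ := h
  obtain ⟨G', hG', h'⟩ := h'
  refine ⟨G * G', mul_ne_zero hG hG', fun a ha => ?_⟩
  rw [map_mul] at ha
  exact ⟨h a (left_ne_zero_of_mul ha), h' a (right_ne_zero_of_mul ha)⟩

theorem holdsGenerically_forall {ι : Type*} [Finite ι] {Q : ι → (τ → ℂ) → Prop}
    (h : ∀ i, HoldsGenerically (Q i)) : HoldsGenerically fun a => ∀ i, Q i a := by
  have := Fintype.ofFinite ι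
  choose G hG h using h
  refine ⟨∏ i, G i, Finset.prod_ne_zero_iff.2 fun i _ => hG i, fun a ha i => h i a ?_⟩
  rw [map_prod] at ha
  exact Finset.prod_ne_zero_iff.1 ha i (Finset.mem_univ i)

theorem holdsGenerically_forall_mem {α : Type*} {S : Set α} (hS : S.Finite)
    {Q : α → (τ → ℂ) → Prop} (h : ∀ i ∈ S, HoldsGenerically (Q i)) :
    HoldsGenerically fun a => ∀ i ∈ S, Q i a := by
  have := hS.to_subtype
  exact (holdsGenerically_forall fun i : S => h i i.2).mono fun a ha i hi => ha ⟨i, hi⟩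

theorem HoldsGenerically.comp {Q : (τ → ℂ) → Prop} (h : HoldsGenerically Q) {f : τ → ε}
    (hf : Function.Injective f) : HoldsGenerically fun a : ε → ℂ => Q (a ∘ f) := by
  obtain ⟨G, hG, h⟩ := h
  refine ⟨rename f G, (map_ne_zero_iff _ (rename_injective f hf)).2 hG, fun a ha => h _ ?_⟩
  rwa [aeval_rename] at ha

/-- For generic values of some of the variables, a nonzero polynomial remains nonzero: it is
enough that one of its coefficients does not vanish. -/
theorem holdsGenerically_specialize_ne_zero {F : MvPolynomial (τ ⊕ ε) ℂ} (hF : F ≠ 0) :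
    HoldsGenerically fun a : τ → ℂ =>
      ∃ F' : MvPolynomial ε ℂ, F' ≠ 0 ∧ ∀ y, aeval y F' = aeval (Sum.elim a y) F := by
  let e := (renameEquiv ℂ (Equiv.sumComm τ ε)).trans (sumAlgEquiv ℂ ε τ)
  have heF : e F ≠ 0 := (map_ne_zero_iff _ e.injective).2 hF
  obtain ⟨m, hm⟩ := MvPolynomial.ne_zero_iff.1 heF
  refine ⟨_, hm, fun a ha => ⟨MvPolynomial.map (aeval a : MvPolynomial τ ℂ →ₐ[ℂ] ℂ).toRingHom (e F),
    fun h => ha ?_, fun y => ?_⟩⟩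
  · have := congrArg (coeff m) h
    rwa [coeff_map] at this
  · have key : (aeval y).comp ((mapAlgHom (aeval a)).comp (e : _ →ₐ[ℂ] MvPolynomial ε _)) =
        (aeval (Sum.elim a y) : MvPolynomial (τ ⊕ ε) ℂ →ₐ[ℂ] ℂ) := by
      ext i
      rcases i with i | i <;> simp [e]
    exact DFunLike.congr_fun key F

/-- Given more polynomial functions on `𝔸^β × C` than its dimension `|β| + dim C`, there is a
nontrivial polynomial relation between them. -/
theorem IsIrreducibleVariety.exists_relation [Finite σ] {β ι : Type} [Fintype β] [Fintype ι]
    {C : Set (σ → ℂ)} (hC : IsIrreducibleVariety C) {j : ℕ} (hj : varietyDim C = j)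
    (hcard : j + Fintype.card β < Fintype.card ι) (u : ι → MvPolynomial (β ⊕ σ) ℂ) :
    ∃ F : MvPolynomial ι ℂ, F ≠ 0 ∧
      ∀ b, ∀ x ∈ C, aeval (fun i => aeval (Sum.elim b x) (u i)) F = 0 := by
  have := hC.isPrime
  set A := MvPolynomial σ ℂ ⧸ vanishingIdeal ℂ C
  let θ : MvPolynomial (β ⊕ σ) ℂ →ₐ[ℂ] MvPolynomial β A :=
    aeval (Sum.elim X fun i => MvPolynomial.C (Ideal.Quotient.mk _ (X i)))
  have hnot : ¬ AlgebraicIndependent ℂ fun i => θ (u i) := by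
    intro hind
    have h1 := hind.cardinalMk_le_trdeg
    rw [← trdeg_add_eq ℂ A, MvPolynomial.trdeg_of_isDomain] at h1
    have h2 : Algebra.trdeg ℂ A = (j : Cardinal) := by
      obtain ⟨d, hd⟩ :=
        Cardinal.lt_aleph0.1 (trdeg_lt_aleph0_of_finiteType (R := ℂ) (S := A))
      have := hC.varietyDim_eq
      rw [hj] at this
      norm_cast at this
      change j = (Algebra.trdeg ℂ A).toNat at this
      rw [hd] at this ⊢
      simpa using this.symm
    rw [h2] at h1
    simp only [Cardinal.mk_fintype, Cardinal.lift_natCast] at h1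
    norm_cast at h1
    omega
  rw [algebraicIndependent_iff] at hnot
  push Not at hnot
  obtain ⟨F, hF0, hF⟩ := hnot
  refine ⟨F, hF, fun b x hx => ?_⟩
  let ev : A →ₐ[ℂ] ℂ := Ideal.Quotient.liftₐ _ (aeval x) fun f hf => hf x hx
  let Ev : MvPolynomial β A →ₐ[ℂ] ℂ :=
    { eval₂Hom ev.toRingHom b with
      commutes' := fun c => by
        simp [MvPolynomial.algebraMap_apply] }
  have hEv (f : MvPolynomial (β ⊕ σ) ℂ) : Ev (θ f) = aeval (Sum.elim b x) f := by
    rw [← AlgHom.comp_apply]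
    congr 1
    ext i
    rcases i with i | i
    · simp [θ, Ev]
    · simp only [θ, Ev, AlgHom.comp_apply, aeval_X, Sum.elim_inr, AlgHom.coe_mk, coe_eval₂Hom,
        eval₂_C]
      exact aeval_X x i
  have := congrArg Ev hF0
  rw [map_zero, ← AlgHom.comp_apply, comp_aeval] at this
  simpa only [hEv] using this

end Generic

/-! ### Generic linear sections -/

section LinearSections

variable {n k r : ℕ}

/-- The generic upper bound for sections of `C` by `k` affine hyperplanes. -/
theorem IsIrreducibleVariety.holdsGenerically_varietyDim_affine_section_lt {C : Set (Fin n → ℂ)}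
    (hC : IsIrreducibleVariety C) {j e : ℕ} (hj : varietyDim C = j) (hje : j < k + e) :
    HoldsGenerically fun a : Fin k × Option (Fin n) → ℂ => ∀ W, IsIrreducibleVariety W → W ⊆ C →
      (∀ x ∈ W, ∀ i, a (i, none) + ∑ l, a (i, some l) * x l = 0) → varietyDim W < e := by
  -- the coefficients of the variables are free parameters, and they determine the constant terms
  let w (u : Fin e → Fin n) :
      (Fin k × Option (Fin n)) ⊕ Fin e → MvPolynomial ((Fin k × Fin n) ⊕ Fin n) ℂ :=
    Sum.elim (fun t => t.2.elim (-∑ l, X (Sum.inl (t.1, l)) * X (Sum.inr l))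
      fun l => X (Sum.inl (t.1, l))) fun l => X (Sum.inr (u l))
  have hF (u : Fin e → Fin n) := hC.exists_relation hj (by simp; nlinarith) (w u)
  choose F hF0 hF using hF
  refine (holdsGenerically_forall fun u => holdsGenerically_specialize_ne_zero (hF0 u)).mono
    fun a ha W hW hWC h => hW.varietyDim_lt_of_forall_exists fun u => ?_
  obtain ⟨F', hF', hev⟩ := ha u
  refine ⟨F', hF', fun x hx => ?_⟩
  rw [hev, ← hF u (fun t => a (t.1, some t.2)) x (hWC hx)]
  congr 2
  funext t
  rcases t with ⟨i, _ | l⟩ | l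
  · simpa [w] using eq_neg_of_add_eq_zero_left (h x hx i)
  · simp [w]
  · simp [w]

/-- The generic upper bound for sections of `C` by `k` hyperplanes through a fixed point `p`, which
may lie on `C`. -/
theorem IsIrreducibleVariety.holdsGenerically_varietyDim_section_through_lt {C : Set (Fin n → ℂ)}
    (hC : IsIrreducibleVariety C) {j e : ℕ} (hj : varietyDim C = j) (hje : j < k + e)
    (p : Fin n → ℂ) :
    HoldsGenerically fun a : Fin k × Fin n → ℂ => ∀ W, IsIrreducibleVariety W → W ⊆ C →
      (∀ x ∈ W, ∀ i, ∑ l, a (i, l) * (x l - p l) = 0) → W = {p} ∨ varietyDim W < e := by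
  -- where `x t ≠ p t`, the coefficients of index different from `t` are free parameters up to the
  -- factor `x t - p t`, and they determine the coefficient of index `t`
  let w (t : Fin n) (u : Fin e → Fin n) : (Fin k × Fin n) ⊕ Fin e →
      MvPolynomial ((Fin k × {l : Fin n // l ≠ t}) ⊕ Fin n) ℂ :=
    Sum.elim (fun v => if h : v.2 = t then
        -∑ l : {l : Fin n // l ≠ t}, X (Sum.inl (v.1, l)) * (X (Sum.inr l.1) - MvPolynomial.C (p l))
      else X (Sum.inl (v.1, ⟨v.2, h⟩)) * (X (Sum.inr t) - MvPolynomial.C (p t)))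
      fun l => X (Sum.inr (u l))
  have hF (t : Fin n) (u : Fin e → Fin n) := hC.exists_relation hj (by
    have : Fintype.card {l : Fin n // l ≠ t} + 1 = n := by
      have := t.pos
      simp [Fintype.card_subtype_compl]
      omega
    simp only [Fintype.card_prod, Fintype.card_sum, Fintype.card_fin]
    nlinarith) (w t u)
  choose F hF0 hF using hF
  refine (holdsGenerically_forall fun t => holdsGenerically_forall fun u =>
    holdsGenerically_specialize_ne_zero (hF0 t u)).mono fun a ha W hW hWC h => ?_
  refine or_iff_not_imp_left.2 fun hWp => ?_
  obtain ⟨y, hy, t, hyt⟩ : ∃ y ∈ W, ∃ t, y t ≠ p t := by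
    by_contra! hcon
    exact hWp (hW.2.1.subset_singleton_iff.1 fun y hy => funext (hcon y hy))
  refine hW.varietyDim_lt_of_forall_exists fun u => ?_
  obtain ⟨F', hF', hev⟩ := ha t u
  refine ⟨F', hF', ?_⟩
  have hprime := hW.isPrime
  have hmem : rename u F' * (X t - MvPolynomial.C (p t)) ∈ vanishingIdeal ℂ W := by
    intro x hx
    rw [map_mul, aeval_rename, hev]
    by_cases hxt : x t - p t = 0
    · simp [hxt]
    refine mul_eq_zero_of_left ?_ _
    rw [← hF t u (fun v => a (v.1, v.2) / (x t - p t)) x (hWC hx)]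
    congr 2
    funext v
    rcases v with ⟨i, l⟩ | l
    · by_cases hl : l = t
      · subst hl
        have := h x hx i
        rw [Fintype.sum_eq_add_sum_subtype_ne _ l] at this
        simp only [w, Sum.elim_inl, dif_pos, map_neg, map_sum, map_mul, map_sub, aeval_X,
          Sum.elim_inr, aeval_C, Algebra.algebraMap_self, RingHom.id_apply]
        simp only [div_mul_eq_mul_div, ← Finset.sum_div]
        rw [← neg_div, eq_div_iff hxt]
        exact eq_neg_of_add_eq_zero_left this
      · simp [w, hl, div_mul_cancel₀ _ hxt]
    · simp [w]
  rcases hprime.mem_or_mem hmem with hm | hm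
  · intro x hx
    rw [← aeval_rename]
    exact hm x hx
  · have := hm y hy
    simp [sub_eq_zero, hyt] at this

/-- The affine linear function whose coefficients are the `i`-th row of `b`. -/
noncomputable def affineForm (b : Fin r × Option (Fin n) → ℂ) (i : Fin r) (x : Fin n → ℂ) : ℂ :=
  b (i, none) + ∑ l, b (i, some l) * x l

/-- The linear variety `L_s` for complex coefficients. -/
def affineSection (b : Fin r × Option (Fin n) → ℂ) (p : Fin n → ℂ) (k : ℕ) (s : ℂ) :
    Set (Fin n → ℂ) :=
  {x | ∀ i : Fin r, (i : ℕ) < k → affineForm b i x = (1 - s) * affineForm b i p}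

theorem aeval_linearPolys (a : Fin r × Option (Fin n) → ℚ) (i : Fin r) (x : Fin n → ℂ) :
    aeval x (linearPolys a i) = affineForm (fun t => (a t : ℂ)) i x := by
  simp [linearPolys, affineForm]

theorem linearSection_linearPolys (a : Fin r × Option (Fin n) → ℚ) (p : Fin n → ℂ) (k : ℕ)
    (s : ℂ) : linearSection (linearPolys a) p k s = affineSection (fun t => (a t : ℂ)) p k s := by
  simp [linearSection, affineSection, aeval_linearPolys]

theorem exists_linearSection_eq (ℓ : Fin r → MvPolynomial (Fin n) ℚ) (p : Fin n → ℂ)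
    (hk : k ≤ r) (s : ℂ) : ∃ g : Fin k → MvPolynomial (Fin n) ℂ,
      linearSection ℓ p k s = {x | ∀ i, aeval x (g i) = 0} := by
  refine ⟨fun i => map (algebraMap ℚ ℂ) (ℓ (Fin.castLE hk i)) -
    C ((1 - s) * aeval p (ℓ (Fin.castLE hk i))), Set.ext fun x => ?_⟩
  simp only [linearSection, Set.mem_ofPred_eq, map_sub, aeval_map_algebraMap, aeval_C,
    Algebra.algebraMap_self, RingHom.id_apply, sub_eq_zero]
  exact ⟨fun h i => h _ i.2, fun h i hi => h ⟨i, hi⟩⟩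

theorem exists_sectionFamily_eq (ℓ : Fin r → MvPolynomial (Fin n) ℚ) (p : Fin n → ℂ)
    (hk : k ≤ r) : ∃ g : Fin k → MvPolynomial (Fin (n + 1)) ℂ,
      sectionFamily ℓ p k = {z | ∀ i, aeval z (g i) = 0} := by
  refine ⟨fun i => rename Fin.castSucc (map (algebraMap ℚ ℂ) (ℓ (Fin.castLE hk i))) -
    (1 - X (Fin.last n)) * C (aeval p (ℓ (Fin.castLE hk i))), Set.ext fun z => ?_⟩
  simp only [sectionFamily, linearSection, Set.mem_ofPred_eq, map_sub, aeval_rename,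
    aeval_map_algebraMap, aeval_C, map_mul, map_one, aeval_X, Algebra.algebraMap_self,
    RingHom.id_apply, sub_eq_zero]
  exact ⟨fun h i => h _ i.2, fun h i hi => h ⟨i, hi⟩⟩

variable {C : Set (Fin n → ℂ)} {j e : ℕ}

theorem IsIrreducibleVariety.holdsGenerically_affineSection_one (hC : IsIrreducibleVariety C)
    (hj : varietyDim C = j) (hje : j < k + e) (hk : k ≤ r) (p : Fin n → ℂ) :
    HoldsGenerically fun b : Fin r × Option (Fin n) → ℂ => ∀ W, IsIrreducibleVariety W → W ⊆ C →
      W ⊆ affineSection b p k 1 → varietyDim W < e := by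
  refine ((hC.holdsGenerically_varietyDim_affine_section_lt (k := k) hj hje).comp
    (f := Prod.map (Fin.castLE hk) id)
    ((Fin.castLE_injective hk).prodMap Function.injective_id)).mono
    fun b hb W hW hWC hWL => hb W hW hWC fun x hx i => ?_
  simpa [affineForm] using hWL hx (Fin.castLE hk i) i.2

theorem IsIrreducibleVariety.holdsGenerically_affineSection_zero (hC : IsIrreducibleVariety C)
    (hj : varietyDim C = j) (hje : j < k + e) (hk : k ≤ r) (p : Fin n → ℂ) :
    HoldsGenerically fun b : Fin r × Option (Fin n) → ℂ => ∀ W, IsIrreducibleVariety W → W ⊆ C →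
      W ⊆ affineSection b p k 0 → W = {p} ∨ varietyDim W < e := by
  refine ((hC.holdsGenerically_varietyDim_section_through_lt (k := k) hj hje p).comp
    (f := Prod.map (Fin.castLE hk) some)
    ((Fin.castLE_injective hk).prodMap (Option.some_injective _))).mono
    fun b hb W hW hWC hWL => hb W hW hWC fun x hx i => ?_
  have := hWL hx (Fin.castLE hk i) i.2
  simpa [affineForm, mul_sub, sub_eq_zero] using this

/-- If `dim C < k`, then `C` is disjoint from `L_s` unless `s` is a root of a polynomial that is
nonzero at `1`. -/
theorem IsIrreducibleVariety.holdsGenerically_affineSection_line (hC : IsIrreducibleVariety C)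
    (hj : varietyDim C = j) (hjk : j < k) (hk : k ≤ r) (p : Fin n → ℂ) :
    HoldsGenerically fun b : Fin r × Option (Fin n) → ℂ => ∃ g : MvPolynomial (Fin 1) ℂ,
      aeval (fun _ => (1 : ℂ)) g ≠ 0 ∧
        ∀ s : ℂ, (C ∩ affineSection b p k s).Nonempty → aeval (fun _ => s) g = 0 := by
  obtain ⟨G, hG, h⟩ := hC.holdsGenerically_affineSection_one (k := k) (e := 0) hj (by simpa) hk p
  refine ⟨G, hG, fun b hb => ?_⟩
  -- substitute into `G` the coefficients of the forms `ℓ i - (1 - s) ℓ i (p)`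
  let γ (t : Fin r × Option (Fin n)) : MvPolynomial (Fin 1) ℂ :=
    t.2.elim (MvPolynomial.C (b (t.1, none)) - (1 - X 0) * MvPolynomial.C (affineForm b t.1 p))
      fun l => MvPolynomial.C (b (t.1, some l))
  have hγ (s : ℂ) : aeval (fun _ => s) (aeval γ G) =
      aeval (fun t => aeval (fun _ => s) (γ t)) G := by
    rw [← AlgHom.comp_apply, comp_aeval]
  refine ⟨aeval γ G, ?_, fun s ⟨x, hxC, hx⟩ => ?_⟩
  · rw [hγ]
    have : (fun t => aeval (fun _ => (1 : ℂ)) (γ t)) = b := by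
      funext t
      rcases t with ⟨i, _ | l⟩ <;> simp [γ]
    rwa [this]
  · rw [hγ]
    by_contra hne
    have := h _ hne {x} (isIrreducibleVariety_singleton x) (by simpa using hxC) (by
      rw [Set.singleton_subset_iff]
      intro i hi
      have := hx i hi
      simp only [affineForm, sub_self, zero_mul, γ] at this ⊢
      simp only [Option.elim_none, map_sub, map_mul, aeval_C, Algebra.algebraMap_self,
        RingHom.id_apply, map_one, aeval_X, Option.elim_some]
      rw [← this]
      ring)
    rw [varietyDim_singleton] at this
    simp at this

end LinearSections

/-! ### Generic position with respect to the components -/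

section Main

variable {n k r : ℕ} {V : Set (Fin n → ℂ)} {p : Fin n → ℂ}

/-- What a generic choice of the linear varieties `L_s` guarantees about their intersections with
the irreducible components of `V`: bounds on dimensions at `s = 1` and `s = 0`, and avoidance of
small components for all but finitely many `s`. -/
structure IsGenericSection (V : Set (Fin n → ℂ)) (p : Fin n → ℂ) (k : ℕ)
    (L : ℂ → Set (Fin n → ℂ)) : Prop where
  dim_one : ∀ C ∈ varietyComponents V, ∀ j : ℕ, varietyDim C = j → ∀ W, IsIrreducibleVariety W →
    W ⊆ C → W ⊆ L 1 → varietyDim W < (j + 1 - k : ℕ)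
  dim_zero : ∀ C ∈ varietyComponents V, ∀ j : ℕ, varietyDim C = j → ∀ W, IsIrreducibleVariety W →
    W ⊆ C → W ⊆ L 0 → W = {p} ∨ varietyDim W < (j + 1 - k : ℕ)
  disjoint : ∀ C ∈ varietyComponents V, ∀ D ∈ varietyComponents V, varietyDim C = k →
    k < varietyDim D → C ∩ D ∩ L 1 = ∅
  line : ∀ C ∈ varietyComponents V, ∀ j : ℕ, varietyDim C = j → j < k →
    ∃ g : MvPolynomial (Fin 1) ℂ, aeval (fun _ => (1 : ℂ)) g ≠ 0 ∧
      ∀ s : ℂ, (C ∩ L s).Nonempty → aeval (fun _ => s) g = 0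

/-- If `C` has dimension `k` and is not contained in `D`, the components of `C ∩ D` have dimension
less than `k` and are missed by a generic linear variety of codimension `k`. -/
theorem IsIrreducibleVariety.holdsGenerically_disjoint {C D : Set (Fin n → ℂ)}
    (hC : IsIrreducibleVariety C) (hD : IsIrreducibleVariety D) (hCD : ¬ C ⊆ D) (hk : k ≤ r)
    (p : Fin n → ℂ) (hCk : varietyDim C = k) :
    HoldsGenerically fun b : Fin r × Option (Fin n) → ℂ => C ∩ D ∩ affineSection b p k 1 = ∅ := by
  have hcl := hC.1.inter hD.1
  refine (holdsGenerically_forall_mem hcl.finite_varietyComponents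
    (Q := fun E b => ∀ W, IsIrreducibleVariety W → W ⊆ E → W ⊆ affineSection b p k 1 →
      varietyDim W < (0 : ℕ)) fun E hE => ?_).mono fun b hb => ?_
  · obtain ⟨e, he⟩ := hE.1.1.exists_varietyDim_eq
    have hlt := hC.varietyDim_lt hE.1.1 ⟨hE.1.2.trans Set.inter_subset_left,
      fun h => hCD ((h.trans hE.1.2).trans Set.inter_subset_right)⟩
    rw [he, hCk] at hlt
    exact hE.1.1.holdsGenerically_affineSection_one he (by exact_mod_cast hlt) hk p
  · rw [Set.eq_empty_iff_forall_notMem]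
    rintro x ⟨hx, hxL⟩
    obtain ⟨E, hE, hxE⟩ := hcl.exists_mem_varietyComponents_of_mem hx
    have := hb E hE {x} (isIrreducibleVariety_singleton x) (by simpa) (by simpa)
    rw [varietyDim_singleton] at this
    simp at this

theorem holdsGenerically_imp {τ : Type} {P : Prop} {Q : (τ → ℂ) → Prop}
    (h : P → HoldsGenerically Q) : HoldsGenerically fun a => P → Q a := by
  by_cases hP : P
  · exact (h hP).mono fun a ha _ => ha
  · exact holdsGenerically_of_forall fun a h => absurd h hP

theorem IsIrreducibleVariety.holdsGenerically_forall_varietyDim_eq {τ : Type}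
    {C : Set (Fin n → ℂ)} (hC : IsIrreducibleVariety C) {Q : ℕ → (τ → ℂ) → Prop}
    (h : ∀ j : ℕ, varietyDim C = j → HoldsGenerically (Q j)) :
    HoldsGenerically fun a => ∀ j : ℕ, varietyDim C = j → Q j a := by
  obtain ⟨j, hj⟩ := hC.exists_varietyDim_eq
  refine (h j hj).mono fun a ha i hi => ?_
  rw [hj] at hi
  norm_cast at hi
  exact hi ▸ ha

theorem holdsGenerically_isGenericSection (hV : IsZariskiClosed V) (p : Fin n → ℂ) (hk : k ≤ r) :
    HoldsGenerically fun b : Fin r × Option (Fin n) → ℂ =>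
      IsGenericSection V p k (affineSection b p k) := by
  have hfin := hV.finite_varietyComponents
  have h1 := holdsGenerically_forall_mem hfin fun C hC =>
    hC.1.1.holdsGenerically_forall_varietyDim_eq fun j hj =>
      hC.1.1.holdsGenerically_affineSection_one (k := k) (r := r) (e := j + 1 - k) hj
        (by omega) hk p
  have h2 := holdsGenerically_forall_mem hfin fun C hC =>
    hC.1.1.holdsGenerically_forall_varietyDim_eq fun j hj =>
      hC.1.1.holdsGenerically_affineSection_zero (k := k) (r := r) (e := j + 1 - k) hj
        (by omega) hk p
  have h3 := holdsGenerically_forall_mem hfin fun C hC =>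
    holdsGenerically_forall_mem hfin fun D hD =>
      holdsGenerically_imp fun hCk : varietyDim C = k =>
        holdsGenerically_imp fun hDk : k < varietyDim D =>
          hC.1.1.holdsGenerically_disjoint (r := r) hD.1.1 (fun h => by
            rw [← h.antisymm (hC.2 hD.1 h), hCk] at hDk
            exact lt_irrefl _ hDk) hk p hCk
  have h4 := holdsGenerically_forall_mem hfin fun C hC =>
    hC.1.1.holdsGenerically_forall_varietyDim_eq fun j hj =>
      holdsGenerically_imp fun hjk : j < k =>
        hC.1.1.holdsGenerically_affineSection_line (r := r) hj hjk hk p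
  exact (((h1.and h2).and h3).and h4).mono fun b ⟨⟨⟨h1, h2⟩, h3⟩, h4⟩ => ⟨h1, h2, h3, h4⟩

/-! ### Sections of the equidimensional parts -/

theorem mem_equidimComponent {σ : Type} {X : Set (σ → ℂ)} {d : ℕ} {x : σ → ℂ} :
    x ∈ equidimComponent X d ↔ ∃ C ∈ varietyComponents X, varietyDim C = d ∧ x ∈ C := by
  simp [equidimComponent, and_assoc]

theorem equidimComponent_subset {σ : Type} (X : Set (σ → ℂ)) (d : ℕ) :
    equidimComponent X d ⊆ X := by
  intro x hx
  obtain ⟨C, hC, -, hxC⟩ := mem_equidimComponent.1 hx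
  exact hC.1.2 hxC

theorem IsIrreducibleVariety.exists_subset_of_subset_equidimComponent {σ : Type} [Finite σ]
    {X W : Set (σ → ℂ)} {d : ℕ} (hX : IsZariskiClosed X) (hW : IsIrreducibleVariety W)
    (h : W ⊆ equidimComponent X d) : ∃ C ∈ varietyComponents X, varietyDim C = d ∧ W ⊆ C := by
  obtain ⟨C, hC, hWC⟩ := hW.exists_subset_of_subset_biUnion
    (hX.finite_varietyComponents.subset fun C hC => hC.1) (fun C hC => hC.1.1.1.1) h
  exact ⟨C, hC.1, hC.2, hWC⟩

/-- Components of the section of `V_j` by `k` equations have dimension at least `j - k`, so an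
upper bound on the dimension of subvarieties suffices for equidimensionality. -/
theorem isEquidimensional_inter {L : Set (Fin n → ℂ)} {j : ℕ} (hV : IsZariskiClosed V)
    (hkj : k ≤ j) (hL : ∃ g : Fin k → MvPolynomial (Fin n) ℂ, L = {x | ∀ i, aeval x (g i) = 0})
    (h : ∀ C ∈ varietyComponents V, varietyDim C = j → ∀ W, IsIrreducibleVariety W → W ⊆ C →
      W ⊆ L → varietyDim W < (j - k + 1 : ℕ)) :
    equidimComponent V j ∩ L = ∅ ∨ IsEquidimensional (j - k) (equidimComponent V j ∩ L) := by
  refine (Set.eq_empty_or_nonempty _).imp_right fun hne => ⟨hne, fun W hW => ?_⟩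
  obtain ⟨C, hC, hCj, hWC⟩ := hW.1.1.exists_subset_of_subset_equidimComponent hV
    (hW.1.2.trans Set.inter_subset_left)
  have hWL : W ⊆ L := hW.1.2.trans Set.inter_subset_right
  obtain ⟨g, rfl⟩ := hL
  have hCV : C ⊆ equidimComponent V j := fun x hx => mem_equidimComponent.2 ⟨C, hC, hCj, hx⟩
  have h1 := hC.1.1.varietyDim_le_add g (W := W) ⟨⟨hW.1.1, Set.subset_inter hWC hWL⟩,
    fun D hD hWD => hW.2 ⟨hD.1, hD.2.trans (Set.inter_subset_inter_left _ hCV)⟩ hWD⟩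
  have h2 := h C hC hCj W hW.1.1 hWC hWL
  obtain ⟨w, hw⟩ := hW.1.1.exists_varietyDim_eq
  rw [hw] at h2 ⊢
  rw [hCj, hw] at h1
  norm_cast at h1 h2 ⊢
  omega

theorem IsGenericSection.condH1 {ℓ : Fin r → MvPolynomial (Fin n) ℚ} (hV : IsZariskiClosed V)
    (hk : k ≤ r) (h : IsGenericSection V p k (linearSection ℓ p k)) : CondH1 V ℓ p k := by
  refine ⟨fun j hkj => ?_, fun j hjk => ?_⟩
  · refine isEquidimensional_inter hV hkj (exists_linearSection_eq ℓ p hk 1)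
      fun C hC hCj W hW hWC hWL => ?_
    rw [← Nat.sub_add_comm hkj]
    exact h.dim_one C hC j hCj W hW hWC hWL
  · rw [Set.eq_empty_iff_forall_notMem]
    rintro x ⟨hx, hxL⟩
    obtain ⟨C, hC, hCj, hxC⟩ := mem_equidimComponent.1 hx
    have := h.dim_one C hC j hCj {x} (isIrreducibleVariety_singleton x) (by simpa) (by simpa)
    rw [varietyDim_singleton, Nat.sub_eq_zero_of_le hjk] at this
    simp at this

theorem IsGenericSection.condH2 {ℓ : Fin r → MvPolynomial (Fin n) ℚ}
    (h : IsGenericSection V p k (linearSection ℓ p k)) : CondH2 V ℓ p k := by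
  rw [CondH2, Set.eq_empty_iff_forall_notMem]
  rintro x ⟨⟨hx, hx'⟩, hxL⟩
  simp only [Set.mem_iUnion] at hx'
  obtain ⟨j, hkj, hx'⟩ := hx'
  obtain ⟨C, hC, hCk, hxC⟩ := mem_equidimComponent.1 hx
  obtain ⟨D, hD, hDj, hxD⟩ := mem_equidimComponent.1 hx'
  have := h.disjoint C hC D hD hCk (by rw [hDj]; exact_mod_cast hkj)
  exact (this ▸ ⟨⟨hxC, hxD⟩, hxL⟩ : x ∈ (∅ : Set (Fin n → ℂ)))

theorem IsGenericSection.condH3 {ℓ : Fin r → MvPolynomial (Fin n) ℚ} (hV : IsZariskiClosed V)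
    (hk : k ≤ r) (h : IsGenericSection V p k (linearSection ℓ p k)) : CondH3 V ℓ p k := by
  refine ⟨fun j hkj => ?_, fun j hjk => ?_⟩
  · refine isEquidimensional_inter hV hkj (exists_linearSection_eq ℓ p hk 0)
      fun C hC hCj W hW hWC hWL => ?_
    rw [← Nat.sub_add_comm hkj]
    rcases h.dim_zero C hC j hCj W hW hWC hWL with rfl | h
    · rw [varietyDim_singleton]
      exact_mod_cast (by omega : 0 < j + 1 - k)
    · exact h
  · rw [← Set.subset_singleton_iff_eq]
    rintro x ⟨hx, hxL⟩
    obtain ⟨C, hC, hCj, hxC⟩ := mem_equidimComponent.1 hx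
    rcases h.dim_zero C hC j hCj {x} (isIrreducibleVariety_singleton x) (by simpa) (by simpa)
      with h | h
    · exact Set.singleton_eq_singleton_iff.1 h
    · rw [varietyDim_singleton, Nat.sub_eq_zero_of_le hjk] at h
      simp at h

/-! ### The deformation -/

theorem liftZero_mem_sectionFamily (ℓ : Fin r → MvPolynomial (Fin n) ℚ) :
    liftZero p ∈ sectionFamily ℓ p k := by
  simp [liftZero, sectionFamily, linearSection]

/-- If no component of `V` through `p` has dimension greater than `k`, then `(p, 0)` is isolated in
the fibre at `s = 0` of the family of sections of `V`. -/
theorem IsGenericSection.eq_singleton_of_last_eq_zero {ℓ : Fin r → MvPolynomial (Fin n) ℚ}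
    (hV : IsZariskiClosed V) (h : IsGenericSection V p k (linearSection ℓ p k))
    (hpk : ∀ j, k < j → p ∉ equidimComponent V j) {T : Set (Fin (n + 1) → ℂ)}
    (hT : IsIrreducibleVariety T) (hTV : T ⊆ cylinder V ∩ sectionFamily ℓ p k)
    (hT0 : ∀ z ∈ T, z (Fin.last n) = 0) (hpT : liftZero p ∈ T) : T = {liftZero p} := by
  have hW := hT.slice hT0
  obtain ⟨C, hC, hWC⟩ := hV.exists_mem_varietyComponents hW
    fun x hx => snoc_mem_cylinder.1 (hTV hx).1
  obtain ⟨j, hj⟩ := hC.1.1.exists_varietyDim_eq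
  have hjk : j ≤ k := by
    by_contra! hlt
    exact hpk j hlt (mem_equidimComponent.2 ⟨C, hC, hj, hWC hpT⟩)
  have hWp : {x : Fin n → ℂ | (Fin.snoc x 0 : Fin (n + 1) → ℂ) ∈ T} = {p} := by
    rcases h.dim_zero C hC j hj _ hW hWC (fun x hx => by
      simpa [sectionFamily] using (hTV hx).2) with hW' | hlt
    · exact hW'
    · refine hW.eq_singleton (hlt.trans_le ?_) hpT
      exact_mod_cast (by omega : j + 1 - k ≤ 1)
  refine Set.Subset.antisymm (fun z hz => ?_) (by simpa using hpT)
  have hz' : z = Fin.snoc (fun i : Fin n => z i.castSucc) 0 := by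
    rw [← hT0 z hz, snoc_castSucc_last]
  rw [hz'] at hz
  have : (fun i : Fin n => z i.castSucc) = p := by
    have : (fun i : Fin n => z i.castSucc) ∈
      {x : Fin n → ℂ | (Fin.snoc x 0 : Fin (n + 1) → ℂ) ∈ T} := hz
    rwa [hWp] at this
  rw [hz', this]
  rfl

/-- An irreducible set that does not dominate the `s`-line lies over a single point of it. -/
theorem IsIrreducibleVariety.last_eq_of_closure_ne_univ {W : Set (Fin (n + 1) → ℂ)}
    (hW : IsIrreducibleVariety W) (h : zariskiClosure (projLast '' W) ≠ Set.univ)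
    {z₀ : Fin (n + 1) → ℂ} (hz₀ : z₀ ∈ W) : ∀ z ∈ W, z (Fin.last n) = z₀ (Fin.last n) := by
  obtain ⟨g, hg, hg0⟩ : ∃ g ∈ vanishingIdeal ℂ (projLast '' W), g ≠ 0 := by
    by_contra! hcon
    refine h (Set.eq_univ_of_forall fun y g hg => ?_)
    rw [hcon g hg, map_zero]
  let q : Polynomial ℂ := uniqueAlgEquiv ℂ (Fin 1) g
  have hq0 : q ≠ 0 := (map_ne_zero_iff _ (uniqueAlgEquiv ℂ (Fin 1)).injective).2 hg0
  have hroot (z) (hz : z ∈ W) : z (Fin.last n) ∈ q.roots.toFinset := by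
    rw [Multiset.mem_toFinset, Polynomial.mem_roots hq0, Polynomial.IsRoot.def]
    have h1 := hg _ (Set.mem_image_of_mem projLast hz)
    have h2 : Polynomial.aeval (z (Fin.last n)) q = aeval (projLast z) g := by
      have key : (Polynomial.aeval (z (Fin.last n))).comp
          (uniqueAlgEquiv ℂ (Fin 1) : _ →ₐ[ℂ] Polynomial ℂ) = aeval (projLast z) := by
        ext i
        simp [projLast]
      exact DFunLike.congr_fun key g
    rwa [← h2] at h1
  obtain ⟨_, ⟨s, -, rfl⟩, hs⟩ := hW.exists_subset_of_subset_biUnion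
    (S := (fun s : ℂ => {z : Fin (n + 1) → ℂ | z (Fin.last n) = s}) '' q.roots.toFinset)
    (q.roots.toFinset.finite_toSet.image _) (by
      rintro _ ⟨s, -, rfl⟩
      convert isZariskiClosed_setOf (X (Fin.last n) - C s : MvPolynomial (Fin (n + 1)) ℂ) using 1
      ext z
      simp [sub_eq_zero])
    (fun z hz => by simpa using hroot z hz)
  exact fun z hz => (hs hz).trans (hs hz₀).symm

theorem isZariskiClosed_family {ℓ : Fin r → MvPolynomial (Fin n) ℚ} (hV : IsZariskiClosed V)
    (hk : k ≤ r) : IsZariskiClosed (cylinder V ∩ sectionFamily ℓ p k) := by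
  obtain ⟨g, hg⟩ := exists_sectionFamily_eq ℓ p hk
  exact (isZariskiClosed_cylinder hV).inter (hg ▸ isZariskiClosed_setOf_forall g)

theorem mem_deformationVariety {ℓ : Fin r → MvPolynomial (Fin n) ℚ} {z : Fin (n + 1) → ℂ} :
    z ∈ deformationVariety V ℓ p k ↔ ∃ W ∈ varietyComponents (cylinder V ∩ sectionFamily ℓ p k),
      zariskiClosure (projLast '' W) = Set.univ ∧ z ∈ W := by
  simp [deformationVariety, and_assoc]

/-- A component of dimension `k` through `p` deforms: the `k` equations cut a curve through
`(p, 0)` out of its cylinder, and that curve cannot stay in the fibre at `s = 0`. -/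
theorem IsGenericSection.liftZero_mem_equidimComponent {ℓ : Fin r → MvPolynomial (Fin n) ℚ}
    (hV : IsZariskiClosed V) (hk : k ≤ r) (h : IsGenericSection V p k (linearSection ℓ p k))
    (hpk : ∀ j, k < j → p ∉ equidimComponent V j) (hp : p ∈ equidimComponent V k) :
    liftZero p ∈ equidimComponent (deformationVariety V ℓ p k) 1 := by
  obtain ⟨C, hC, hCk, hpC⟩ := mem_equidimComponent.1 hp
  obtain ⟨g, hg⟩ := exists_sectionFamily_eq ℓ p hk
  have hsub : cylinder C ∩ sectionFamily ℓ p k ⊆ cylinder V ∩ sectionFamily ℓ p k :=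
    Set.inter_subset_inter_left _ fun z hz => hC.1.2 hz
  obtain ⟨W', hW', hpW'⟩ := (isZariskiClosed_family (ℓ := ℓ) (p := p) hC.1.1.1
    hk).exists_mem_varietyComponents_of_mem
      ⟨snoc_mem_cylinder.2 hpC, liftZero_mem_sectionFamily ℓ⟩
  obtain ⟨W, hW, hWW'⟩ := (isZariskiClosed_family (ℓ := ℓ) (p := p) hV
    hk).exists_mem_varietyComponents hW'.1.1 (hW'.1.2.trans hsub)
  have hpW := hWW' hpW'
  obtain ⟨w, hw⟩ := hW.1.1.exists_varietyDim_eq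
  have hw1 : 1 ≤ w := by
    have h1 := hC.1.1.add_one_le_varietyDim_cylinder hCk
    rw [hg] at hW'
    have h2 := h1.trans (hC.1.1.cylinder.varietyDim_le_add g hW')
    have h3 := h2.trans (add_le_add_left (varietyDim_mono hWW') _)
    rw [hw] at h3
    norm_cast at h3
    omega
  have hdom : zariskiClosure (projLast '' W) = Set.univ := by
    by_contra hne
    have h0 := hW.1.1.last_eq_of_closure_ne_univ hne hpW
    have := h.eq_singleton_of_last_eq_zero hV hpk hW.1.1 hW.1.2
      (fun z hz => (h0 z hz).trans (by simp)) hpW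
    rw [this, varietyDim_singleton] at hw
    norm_cast at hw
    omega
  have hw1' : w ≤ 1 := by
    have hcl := hW.1.1.1.inter (isZariskiClosed_setOf_forall
      fun _ : Fin 1 => (X (Fin.last n) : MvPolynomial (Fin (n + 1)) ℂ))
    obtain ⟨T, hT, hpT⟩ := hcl.exists_mem_varietyComponents_of_mem
      (x := liftZero p) ⟨hpW, by simp [liftZero]⟩
    have h1 := hW.1.1.varietyDim_le_add _ hT
    have hTp := h.eq_singleton_of_last_eq_zero hV hpk hT.1.1
      ((hT.1.2.trans Set.inter_subset_left).trans hW.1.2)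
      (fun z hz => by simpa using (hT.1.2 hz).2 0) hpT
    rw [hTp, varietyDim_singleton, hw] at h1
    exact_mod_cast h1
  have hWsub : W ⊆ deformationVariety V ℓ p k :=
    fun z hz => mem_deformationVariety.2 ⟨W, hW, hdom, hz⟩
  refine mem_equidimComponent.2 ⟨W, ⟨⟨hW.1.1, hWsub⟩, fun D hD hWD => hW.2 ⟨hD.1, ?_⟩ hWD⟩, ?_, hpW⟩
  · refine hD.2.trans fun z hz => ?_
    obtain ⟨W₁, hW₁, -, hz₁⟩ := mem_deformationVariety.1 hz
    exact hW₁.1.2 hz₁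
  · rw [hw, le_antisymm hw1' hw1]

/-- A dominating component through `(p, 0)` cannot come from a component of `V` of dimension less
than `k`, since such a component misses `L_s` for almost all `s`. -/
theorem IsGenericSection.mem_equidimComponent_of_liftZero_mem
    {ℓ : Fin r → MvPolynomial (Fin n) ℚ} (hV : IsZariskiClosed V)
    (h : IsGenericSection V p k (linearSection ℓ p k))
    (hpk : ∀ j, k < j → p ∉ equidimComponent V j)
    (hp : liftZero p ∈ deformationVariety V ℓ p k) : p ∈ equidimComponent V k := by
  obtain ⟨W, hW, hdom, hpW⟩ := mem_deformationVariety.1 hp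
  have hcov : W ⊆ ⋃ D ∈ cylinder '' varietyComponents V, D := by
    intro z hz
    obtain ⟨C, hC, hzC⟩ := hV.exists_mem_varietyComponents_of_mem (hW.1.2 hz).1
    simp only [Set.mem_iUnion]
    exact ⟨_, ⟨C, hC, rfl⟩, hzC⟩
  obtain ⟨_, ⟨C, hC, rfl⟩, hWC⟩ := hW.1.1.exists_subset_of_subset_biUnion
    (hV.finite_varietyComponents.image _) (by
      rintro _ ⟨C, hC, rfl⟩
      exact isZariskiClosed_cylinder hC.1.1.1) hcov
  have hpC : p ∈ C := snoc_mem_cylinder.1 (hWC hpW)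
  obtain ⟨j, hj⟩ := hC.1.1.exists_varietyDim_eq
  have hpj : p ∈ equidimComponent V j := mem_equidimComponent.2 ⟨C, hC, hj, hpC⟩
  rcases lt_trichotomy j k with hjk | rfl | hjk
  · obtain ⟨g, hg1, hg⟩ := h.line C hC j hj hjk
    refine absurd ?_ hg1
    have hgW : g ∈ vanishingIdeal ℂ (projLast '' W) := by
      rintro _ ⟨z, hz, rfl⟩
      exact hg (z (Fin.last n)) ⟨_, hWC hz, (hW.1.2 hz).2⟩
    have : (fun _ => 1 : Fin 1 → ℂ) ∈ zariskiClosure (projLast '' W) := hdom ▸ Set.mem_univ _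
    exact this g hgW
  · exact hpj
  · exact absurd hpj (hpk j hjk)

theorem isZariskiClosed_commonZeros {m : ℕ} (f : Fin m → MvPolynomial (Fin n) ℚ) :
    IsZariskiClosed (commonZeros f) := by
  simpa [aeval_map_algebraMap, commonZeros] using
    isZariskiClosed_setOf_forall fun j => map (algebraMap ℚ ℂ) (f j)

/-- On a subvariety of a hypersurface the coordinates are algebraically dependent. -/
theorem varietyDim_lt_of_subset_commonZeros {m : ℕ} {f : Fin m → MvPolynomial (Fin n) ℚ}
    (hf : ∃ j, f j ≠ 0) {C : Set (Fin n → ℂ)} (hC : IsIrreducibleVariety C)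
    (h : C ⊆ commonZeros f) : varietyDim C < n := by
  obtain ⟨j, hj⟩ := hf
  refine hC.varietyDim_lt_of_forall_exists fun u => ?_
  by_cases hu : Function.Injective u
  · let e : Fin n ≃ Fin n := Equiv.ofBijective u (Finite.injective_iff_bijective.1 hu)
    refine ⟨rename e.symm (map (algebraMap ℚ ℂ) (f j)), ?_, fun x hx => ?_⟩
    · exact (map_ne_zero_iff _ (rename_injective _ e.symm.injective)).2
        ((map_ne_zero_iff _ (map_injective _ (algebraMap ℚ ℂ).injective)).2 hj)
    · have : (x ∘ u) ∘ e.symm = x := by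
        funext i
        exact congrArg x (e.apply_symm_apply i)
      rw [aeval_rename, this, aeval_map_algebraMap]
      exact h hx j
  · simp only [Function.Injective, not_forall] at hu
    obtain ⟨a, b, hab, hne⟩ := hu
    refine ⟨X a - X b, sub_ne_zero.2 fun h => hne (X_injective h), fun x _ => ?_⟩
    simp [hab]

end Main

theorem mainTheorem4 {n m : ℕ} (hn : 2 ≤ n) (f : Fin m → MvPolynomial (Fin n) ℚ)
    (hf : ∃ j, f j ≠ 0) (p : Fin n → ℂ) (hp : p ∈ commonZeros f) :
    ∃ G : MvPolynomial (Fin (n - 1) × Option (Fin n)) ℂ, G ≠ 0 ∧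
      ∀ a : Fin (n - 1) × Option (Fin n) → ℚ, aeval (fun t => (a t : ℂ)) G ≠ 0 →
        (∀ k, 1 ≤ k → k ≤ n - 1 →
          CondH1 (commonZeros f) (linearPolys a) p k ∧
          CondH2 (commonZeros f) (linearPolys a) p k ∧
          CondH3 (commonZeros f) (linearPolys a) p k) ∧
        (p ∈ equidimComponent (commonZeros f) (n - 1) ↔
          liftZero p ∈ deformationVariety (commonZeros f) (linearPolys a) p (n - 1)) ∧
        (∀ k, 1 ≤ k → k ≤ n - 1 →
          p ∉ (⋃ j ∈ {j : ℕ | k < j}, equidimComponent (commonZeros f) j) →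
          List.TFAE
            [p ∈ equidimComponent (commonZeros f) k,
              liftZero p ∈
                equidimComponent (deformationVariety (commonZeros f) (linearPolys a) p k) 1,
              liftZero p ∈ deformationVariety (commonZeros f) (linearPolys a) p k]) := by
  have hV := isZariskiClosed_commonZeros f
  obtain ⟨G, hG, hgen⟩ := holdsGenerically_forall_mem (Set.finite_Iic (n - 1)) fun k hk =>
    holdsGenerically_isGenericSection (k := k) (r := n - 1) hV p hk
  refine ⟨G, hG, fun a ha => ?_⟩
  have hsec (k : ℕ) (hk : k ≤ n - 1) :
      IsGenericSection (commonZeros f) p k (linearSection (linearPolys a) p k) := by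
    have := hgen _ ha k hk
    rwa [← funext (linearSection_linearPolys a p k)] at this
  refine ⟨fun k _ hk => ⟨(hsec k hk).condH1 hV hk, (hsec k hk).condH2, (hsec k hk).condH3 hV hk⟩,
    ?_, fun k _ hk hpk => ?_⟩
  · have htop (j : ℕ) (hj : n - 1 < j) : p ∉ equidimComponent (commonZeros f) j := by
      intro hpj
      obtain ⟨C, hC, hCj, -⟩ := mem_equidimComponent.1 hpj
      have := varietyDim_lt_of_subset_commonZeros hf hC.1.1 hC.1.2
      rw [hCj] at this
      norm_cast at this
      omega
    exact ⟨fun h => equidimComponent_subset _ _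
        ((hsec _ le_rfl).liftZero_mem_equidimComponent hV le_rfl htop h),
      (hsec _ le_rfl).mem_equidimComponent_of_liftZero_mem hV htop⟩
  · simp only [Set.mem_iUnion, Set.mem_ofPred_eq, not_exists] at hpk
    tfae_have 1 → 2 := (hsec k hk).liftZero_mem_equidimComponent hV hk hpk
    tfae_have 2 → 3 := fun h => equidimComponent_subset _ _ h
    tfae_have 3 → 1 := (hsec k hk).mem_equidimComponent_of_liftZero_mem hV hpk
    tfae_finish
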